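/- **Proposition 4.1.** *Notation.* For a finite simplicial complex $F$ let $s_i(F)$ be the number of its $i$-simplices. An unordered copy of $F$ in a complex $K$ is a subcomplex of $K$ isomorphic to $F$, and $n(K,F)$ is the number of these; an ordered copy of $F$ in $K$ is an injective simplicial map from the vertices of $F$ to the vertices of $K$. For $p_1,p_2,\dots\in[0,1]$ let $K(n;p_1,\dots,p_{n-1})$ be the multi-parameter random simplicial complex on $\{1,\dots,n\}$: all vertices are present and, recursively for $i=1,\dots,n-1$, each potential $i$-simplex whose boundary is already present is added with probability $p_i$, independently of the other potential $i$-simplices. Let $N_{o,n}(F)$ be the number of ordered copies of $F$ in $K(n;p_1,\dots,p_{n-1})$ and $\mu_{o,n}(F)=\mathbb E[N_{o,n}(F)]$. Let $N(m_0,\dots,m_k;H)$ be the maximum of $n(F,H)$ over all simplicial complexes $F$ with $s_i(F)\le m_i$, $i=0,\dots,k$, and let $\Psi_{H,n}=n^{s_0(H)}\prod_{i=1}^k p_i^{s_i(H)}$. For a $k$-dimensional complex $G$ let $M^*_{G,n}(p_1,\dots,p_k)$ be the largest integer $m$ with $1\le m\le \binom{n}{k+1}/s_k(G)$ such that $$N\bigl(n,ms_1(G),\dots,ms_k(G);H\bigr)\le\Psi_{H,n}\quad\text{for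 every nonempty subcomplex } H \text{ of } G$$ (and $0$ if there is none). Let $\sigma_k$ denote the $k$-simplex. *Statement.* Let $k\ge1$. There is a constant $C_k\ge 1$, depending only on $k$, and for every $\varepsilon>0$ there are constants $C_k'(\varepsilon),C_k''(\varepsilon)>0$, depending only on $k$ and $\varepsilon$, such that the following holds. Let $p_i=n^{-\alpha_i}$ with $\alpha_i\in[0,\infty]$, $i\ge1$ (where $n^{-\infty}=0$), and suppose that $$\sum_{i=1}^k\binom ki\alpha_i<1\quad\text{and}\quad q:=\min\{i\ge1:\alpha_i>0\}\le k.$$ If $q<k$, suppose also that for every $k_0=q+1,\dots,k$, $$\frac{k-q}{k+1}\binom{k+1}{q+1}\alpha_q+\sum_{j=q+1}^{k_0}\binom{k+1}{j+1}\alpha_j<k_0-q.$$ Then, for all large enough $n$, $$C_k^{-1}\,n^{q+1-\binom kq\alpha_q}\le M^*_{\sigma_k,n}\bigl(n^{-\alpha_1},\dots,n^{-\alpha_k}\bigr)\le C_k\,n^{q+1-\binom kq\alpha_q},$$ and, for every $\varepsilon>0$ and all large enough $n$, $$\exp\Bigl\{-C_k'(\varepsilon)\,n^{q+1-\binom kq\alpha_q}\log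 n\Bigr\}\le\mathbb P\bigl(N_{o,n}(\sigma_k)\ge(1+\varepsilon)\mu_{o,n}(\sigma_k)\bigr)\le\exp\Bigl\{-C_k''(\varepsilon)\,n^{q+1-\binom kq\alpha_q}\Bigr\}.$$ ("Large enough" may depend on $k$ and the $\alpha_i$ and, in the last display, also on $\varepsilon$.) -/

import Mathlib

open MeasureTheory ProbabilityTheory Filter
open scoped ENNReal

noncomputable section

namespace SimplexTail

/-! ### Counting in abstract simplicial complexes

`PreAbstractSimplicialComplex V` is a complex whose vertices are *some* of the elements of `V`,
which is what subcomplexes require. The counts below are meant for finite `V` and `W`. -/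

variable {V W : Type*}

/-- The vertex set of a complex. -/
def vertices (K : PreAbstractSimplicialComplex V) : Set V := {v | {v} ∈ K}

/-- The number `s_i(K)` of `i`-simplices of `K`; these have `i + 1` vertices. -/
def numSimplices (K : PreAbstractSimplicialComplex V) (i : ℕ) : ℕ :=
  {σ : Finset V | σ ∈ K ∧ σ.card = i + 1}.ncard

/-- Ordered copies of `F` in `K`: injective simplicial maps from the vertices of `F` to those
of `K`. (As vertices are simplices, such a map automatically takes values in the vertices
of `K`.) -/
def orderedCopies (K : PreAbstractSimplicialComplex V) (F : PreAbstractSimplicialComplex W) :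
    Set (vertices F ↪ V) :=
  {f | ∀ s : Finset (vertices F), s.map (Function.Embedding.subtype _) ∈ F → s.map f ∈ K}

/-- The number `n_o(K, F)` of ordered copies of `F` in `K`. -/
def numOrdered (K : PreAbstractSimplicialComplex V) (F : PreAbstractSimplicialComplex W) : ℕ :=
  (orderedCopies K F).ncard

/-- Isomorphism of complexes: a bijection of the vertex sets under which a set of vertices is
a simplex if and only if its image is. -/
def IsIso (F : PreAbstractSimplicialComplex W) (K : PreAbstractSimplicialComplex V) : Prop :=
  ∃ e : vertices F ≃ vertices K, ∀ s : Finset (vertices F),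
    s.map (Function.Embedding.subtype _) ∈ F ↔
      (s.map e.toEmbedding).map (Function.Embedding.subtype _) ∈ K

/-- The number `n(K, F)` of unordered copies of `F` in `K`: subcomplexes of `K` isomorphic
to `F`. -/
def numUnordered (K : PreAbstractSimplicialComplex V) (F : PreAbstractSimplicialComplex W) : ℕ :=
  {L : PreAbstractSimplicialComplex V | L ≤ K ∧ IsIso F L}.ncard

/-- The extremal parameter `N(m_0, …, m_k; G)`: the maximum of `n(F, G)` over all complexes `F`
with `s_i(F) ≤ m_i` for `i = 0, …, k`. As `F` has at most `m_0` vertices, it may be taken, up to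
isomorphism, with vertices in `Fin (m 0)`, so that this is a maximum over a finite nonempty
family. -/
def extremalNumber (k : ℕ) (m : ℕ → ℕ) (G : PreAbstractSimplicialComplex W) : ℕ :=
  ⨆ F : {F : PreAbstractSimplicialComplex (Fin (m 0)) // ∀ i ≤ k, numSimplices F i ≤ m i},
    numUnordered F.1 G

/-- `Ψ_{G,n} = n^{s_0(G)} ∏_{i=1}^k p_i^{s_i(G)}`. -/
def Psi (k n : ℕ) (p : ℕ → unitInterval) (G : PreAbstractSimplicialComplex W) : ℝ :=
  (n : ℝ) ^ numSimplices G 0 * ∏ i ∈ Finset.Icc 1 k, (p i : ℝ) ^ numSimplices G i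

/-- For a complex `G` of dimension `k`, the number `M^*_{G,n}(p_1, …, p_k)`: the largest integer
`m` with `1 ≤ m ≤ (n choose k+1) / s_k(G)` such that
`N(n, m s_1(G), …, m s_k(G); H) ≤ Ψ_{H,n}` for every nonempty subcomplex `H` of `G`
(and `0` if there is no such `m`). -/
def Mstar (k n : ℕ) (p : ℕ → unitInterval) (G : PreAbstractSimplicialComplex W) : ℕ :=
  sSup {m : ℕ | 1 ≤ m ∧ (m : ℝ) ≤ (n.choose (k + 1) : ℝ) / (numSimplices G k : ℝ) ∧
    ∀ H : PreAbstractSimplicialComplex W, H ≤ G → H ≠ ⊥ →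
      (extremalNumber k (fun i => if i = 0 then n else m * numSimplices G i) H : ℝ)
        ≤ Psi k n p H}

/-- The `k`-simplex `σ_k`: all nonempty subsets of a set of `k + 1` vertices. -/
def simplex (k : ℕ) : PreAbstractSimplicialComplex (Fin (k + 1)) := ⊤

/-! ### The multi-parameter random simplicial complex -/

/-- Given the outcomes `ω` of the coins attached to the potential simplices, the simplices of the
recursively constructed complex: every vertex is present, and a potential simplex of dimension
at least `1` is added if all its codimension-one faces have been added and its own coin shows
`true`. -/
inductive IsFace [DecidableEq V] (ω : Finset V → Bool) : Finset V → Prop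
  | vertex (v : V) : IsFace ω {v}
  | add (σ : Finset V) (hdim : 2 ≤ σ.card) (hbdry : ∀ v ∈ σ, IsFace ω (σ.erase v))
      (hcoin : ω σ = true) : IsFace ω σ

theorem IsFace.nonempty [DecidableEq V] {ω : Finset V → Bool} {σ : Finset V}
    (h : IsFace ω σ) : σ.Nonempty := by
  cases h with
  | vertex v => exact Finset.singleton_nonempty v
  | add _ hdim _ _ => exact Finset.card_pos.mp (by omega)

theorem IsFace.subface [DecidableEq V] {ω : Finset V → Bool} {σ : Finset V}
    (h : IsFace ω σ) : ∀ τ : Finset V, τ ⊆ σ → τ.Nonempty → IsFace ω τ := by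
  induction h with
  | vertex v =>
    intro τ hτ hne
    rcases Finset.subset_singleton_iff.mp hτ with h | h
    · exact absurd h hne.ne_empty
    · rw [h]; exact IsFace.vertex v
  | add σ hdim hbdry hcoin ih =>
    intro τ hτ hne
    by_cases hστ : σ ⊆ τ
    · rw [Finset.Subset.antisymm hτ hστ]; exact IsFace.add σ hdim hbdry hcoin
    · obtain ⟨v, hv, hvτ⟩ := Finset.not_subset.mp hστ
      exact ih v hv τ (Finset.subset_erase.mpr ⟨hτ, hvτ⟩) hne

/-- The complex on the vertex set `V` built from the coins `ω`. -/
def coinComplex [DecidableEq V] (ω : Finset V → Bool) : PreAbstractSimplicialComplex V where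
  faces := {σ | IsFace ω σ}
  isRelLowerSet_faces := fun {_} h => ⟨h.nonempty, fun {τ} hτ hne => h.subface τ hτ hne⟩

/-- The law of independent coins attached to the sets of vertices in `{1, …, n}`: the coin of a
potential `i`-simplex shows `true` with probability `p_i`. The random complex `K(n; p_1, p_2, …)`
is `coinComplex ω` for `ω` with this law (the coins of sets with fewer than two elements are never
used, so `p_0` plays no role). -/
def coinMeasure (n : ℕ) (p : ℕ → unitInterval) : Measure (Finset (Fin n) → Bool) :=
  Measure.pi fun σ => bernoulliMeasure true false (p (σ.card - 1))

/-- The number `N_{o,n}(F)` of ordered copies of `F` in the random complex. -/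
def orderedCount (n : ℕ) (F : PreAbstractSimplicialComplex W) (ω : Finset (Fin n) → Bool) : ℕ :=
  numOrdered (coinComplex ω) F

/-- The mean `μ_{o,n}(F) = 𝔼[N_{o,n}(F)]`. -/
def meanOrdered (n : ℕ) (p : ℕ → unitInterval) (F : PreAbstractSimplicialComplex W) : ℝ :=
  ∫ ω, (orderedCount n F ω : ℝ) ∂coinMeasure n p

/-- The upper tail probability `ℙ(N_{o,n}(F) ≥ (1 + ε) μ_{o,n}(F))`. -/
def upperTail (n : ℕ) (p : ℕ → unitInterval) (F : PreAbstractSimplicialComplex W) (ε : ℝ) : ℝ :=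
  (coinMeasure n p).real {ω | (1 + ε) * meanOrdered n p F ≤ (orderedCount n F ω : ℝ)}

/-! ### Power-law probabilities -/

/-- The probability `n^{-a}` for `a ∈ [0, ∞]`, with `n^{-∞} = 0`. -/
def powProb (n : ℕ) (a : ℝ≥0∞) : unitInterval :=
  if a = ⊤ then 0
  else ⟨(n : ℝ) ^ (-a.toReal), Real.rpow_nonneg n.cast_nonneg _, by
    rcases Nat.eq_zero_or_pos n with h | h
    · subst h
      simpa using Real.zero_rpow_le_one (-a.toReal)
    · exact Real.rpow_le_one_of_one_le_of_nonpos (by exact_mod_cast h)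
        (neg_nonpos.mpr ENNReal.toReal_nonneg)⟩

/-- The dimension `k` is at or below the critical one, `∑_{i=1}^k (k choose i) α_i < 1`, and
`q = min {i ≥ 1 : α_i > 0} ≤ k`. -/
def Subcritical (k q : ℕ) (α : ℕ → ℝ≥0∞) : Prop :=
  ∑ i ∈ Finset.Icc 1 k, (k.choose i : ℝ≥0∞) * α i < 1 ∧
    IsLeast {i : ℕ | 1 ≤ i ∧ 0 < α i} q ∧ q ≤ k

/-- The extra condition, which is void for `q = k`: for every `k₀ = q + 1, …, k`,
`(k - q)/(k + 1) (k+1 choose q+1) α_q + ∑_{j=q+1}^{k₀} (k+1 choose j+1) α_j < k₀ - q`. -/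
def ExtraCondition (k q : ℕ) (α : ℕ → ℝ≥0∞) : Prop :=
  ∀ k₀ : ℕ, q < k₀ → k₀ ≤ k →
    ((k : ℝ) - q) / ((k : ℝ) + 1) * ((k + 1).choose (q + 1) : ℝ) * (α q).toReal
      + ∑ j ∈ Finset.Icc (q + 1) k₀, ((k + 1).choose (j + 1) : ℝ) * (α j).toReal
      < (k₀ : ℝ) - q

/-- The growth order `n^{q + 1 - (k choose q) α_q}`. -/
def growth (k q : ℕ) (α : ℕ → ℝ≥0∞) (n : ℕ) : ℝ :=
  (n : ℝ) ^ ((q : ℝ) + 1 - (k.choose q : ℝ) * (α q).toReal)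

end SimplexTail

end

noncomputable section

namespace SimplexTail

/-! ### The random complex as a family of independent coins -/

/-! Write W for the sum of all α-exponents of the faces of σ_k. A fixed injection maps σ_k into the
random complex with probability n^{-W}; if the simplices of a set B are known to be present, the
faces of the image lying in B become free, and the probability gains n to the sum of their
exponents. Both tail bounds ask how large B must be before the conditional mean of N_o exceeds μ by
a constant factor. The answer is |B| of order n^{q+1-C(k,q)α_q}.

Fewer simplices do not suffice (`exists_sum_faceWeight_sdiff_le`). Faces of dimension below q have
exponent zero. If an image meets B only in dimension at most q, its gain is a product over the
(q+1)-subsets of the k+1 vertices. Each vertex lies in C(k,q) of them, so Finner's inequality with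
all weights 1/C(k,q) bounds the total gain by averages over single q-faces, each at most 1+O(c) when
|B| ≤ c·growth. If an image has a face of dimension k₀ > q in B, there are O(|B| n^{k-k₀}) such
images, and the extra condition says exactly that their contribution is o(n^{k+1}), even with the
largest possible gain. Expanding E[N_o^M] one factor at a time (`moment_le`) then shows that it is
at most ((1+δ)μ)^M for M of order growth, and Markov's inequality gives the upper bound on the tail.

That many do suffice. Plant every q-simplex meeting a set A of about n^{1-C(k,q)α_q} vertices, up to
a constant. A simplex with vertex 0 in A gets its C(k,q) q-faces at that vertex for free, and a
fraction |A|/n of all injections has this property. The planting uses at most |A|n^q coins and costs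
at least exp(-O(growth · log n)); `le_upperTail` converts this into the lower bound.

The bounds on M^* use the same two ideas deterministically. Finner's inequality and the extra
condition bound the copies of each H in a sparse complex (`Subcritical.numUnordered_le_Psi`), while
the star-shaped complex on A has too many copies of the star of a vertex of σ_k
(`exists_Mstar_le_mul_growth`). -/

/-- The simplices of dimension at least `1` spanned by subsets of `S`. -/
def faceSet {V : Type*} (S : Finset V) : Finset (Finset V) :=
  S.powerset.filter fun T => 2 ≤ T.card

theorem mem_faceSet {V : Type*} {S T : Finset V} : T ∈ faceSet S ↔ T ⊆ S ∧ 2 ≤ T.card := by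
  simp [faceSet]

/-- Unrolling the recursion turns presence of a simplex into a condition on independent coins, so
that all probabilities below are products. -/
theorem isFace_iff {V : Type*} [DecidableEq V] {ω : Finset V → Bool} {σ : Finset V} :
    IsFace ω σ ↔ σ.Nonempty ∧ ∀ T ∈ faceSet σ, ω T = true := by
  constructor
  · intro h
    refine ⟨h.nonempty, fun T hT => ?_⟩
    rw [mem_faceSet] at hT
    have hT' := h.subface T hT.1 (Finset.card_pos.mp (by omega))
    cases hT' with
    | vertex v => simp at hT
    | add _ _ _ hc => exact hc
  · induction σ using Finset.strongInduction with
    | H σ ih =>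
      rintro ⟨hne, h⟩
      by_cases hc : 2 ≤ σ.card
      · refine IsFace.add σ hc (fun v hv => ih _ (Finset.erase_ssubset hv) ⟨?_, ?_⟩)
          (h σ (mem_faceSet.mpr ⟨subset_rfl, hc⟩))
        · rw [← Finset.card_pos, Finset.card_erase_of_mem hv]; omega
        · intro T hT
          rw [mem_faceSet] at hT
          exact h T (mem_faceSet.mpr ⟨hT.1.trans (Finset.erase_subset _ _), hT.2⟩)
      · have : σ.card = 1 := by have := hne.card_pos; omega
        obtain ⟨v, rfl⟩ := Finset.card_eq_one.mp this
        exact IsFace.vertex v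

/-- The indicator of the event that all coins of `B` show `true`. -/
def coinIndicator {V : Type*} (B : Finset (Finset V)) (ω : Finset V → Bool) : ℝ :=
  open Classical in if ∀ T ∈ B, ω T = true then 1 else 0

/-- The probability that all coins of `B` show `true`. -/
def faceWeight {V : Type*} (p : ℕ → unitInterval) (B : Finset (Finset V)) : ℝ :=
  ∏ T ∈ B, (p (T.card - 1) : ℝ)

theorem faceWeight_nonneg {V : Type*} (p : ℕ → unitInterval) (B : Finset (Finset V)) :
    0 ≤ faceWeight p B :=
  Finset.prod_nonneg fun _ _ => (p _).2.1

theorem mem_simplex_iff {k : ℕ} {s : Finset (Fin (k + 1))} : s ∈ simplex k ↔ s.Nonempty :=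
  Iff.rfl

theorem vertices_simplex (k : ℕ) : vertices (simplex k) = Set.univ := by
  ext v
  simp only [vertices, Set.mem_ofPred_eq, Set.mem_univ, iff_true]
  exact mem_simplex_iff.mpr (Finset.singleton_nonempty v)

/-- All vertices belong to σ_k, and a map is simplicial as soon as the image of the top simplex is
present, since faces are inherited. -/
theorem orderedCount_simplex_eq_ncard {n k : ℕ} (ω : Finset (Fin n) → Bool) :
    orderedCount n (simplex k) ω =
      {f : Fin (k + 1) ↪ Fin n | ∀ T ∈ faceSet (Finset.univ.map f), ω T = true}.ncard := by
  have hv : ∀ v, v ∈ vertices (simplex k) := fun v => by rw [vertices_simplex]; trivial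
  let e : vertices (simplex k) ≃ Fin (k + 1) := Equiv.subtypeUnivEquiv hv
  let E : (vertices (simplex k) ↪ Fin n) ≃ (Fin (k + 1) ↪ Fin n) :=
    Equiv.embeddingCongr e (Equiv.refl _)
  unfold orderedCount numOrdered
  rw [← Set.ncard_image_of_injective _ E.injective]
  congr 1
  ext f
  rw [Equiv.image_eq_preimage_symm, Set.mem_preimage]
  simp only [orderedCopies, Set.mem_ofPred_eq]
  have key : ∀ s : Finset (vertices (simplex k)),
      s.map (E.symm f) = (s.map e.toEmbedding).map f := by
    intro s
    rw [Finset.map_map]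
    congr 1
  have h2 : ∀ s : Finset (vertices (simplex k)), s.map (Function.Embedding.subtype _) ∈ simplex k
      ↔ s.Nonempty := fun s => by rw [mem_simplex_iff, Finset.map_nonempty]
  have hmem : ∀ σ : Finset (Fin n), σ ∈ coinComplex ω ↔ IsFace ω σ := fun σ => Iff.rfl
  simp only [key, h2, hmem]
  constructor
  · intro h T hT
    have h0 := h (Finset.univ.map e.symm.toEmbedding) (by simp)
    rw [isFace_iff] at h0
    refine h0.2 T ?_
    simpa [Finset.map_map] using hT
  · intro h s hs
    rw [isFace_iff]
    refine ⟨by simpa using hs, fun T hT => h T ?_⟩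
    rw [mem_faceSet] at hT ⊢
    exact ⟨hT.1.trans (Finset.map_subset_map.mpr (Finset.subset_univ _)), hT.2⟩

theorem orderedCount_simplex {n k : ℕ} (ω : Finset (Fin n) → Bool) :
    (orderedCount n (simplex k) ω : ℝ) =
      ∑ f : Fin (k + 1) ↪ Fin n, coinIndicator (faceSet (Finset.univ.map f)) ω := by
  classical
  rw [orderedCount_simplex_eq_ncard]
  have h : ∀ f : Fin (k + 1) ↪ Fin n, coinIndicator (faceSet (Finset.univ.map f)) ω =
      if ∀ T ∈ faceSet (Finset.univ.map f), ω T = true then 1 else 0 := fun f => by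
    unfold coinIndicator
    congr
  rw [Finset.sum_congr rfl fun f _ => h f, Finset.sum_boole, Set.ncard_eq_toFinset_card']
  congr 2
  ext f
  simp

theorem coinIndicator_nonneg {V : Type*} (B : Finset (Finset V)) (ω : Finset V → Bool) :
    0 ≤ coinIndicator B ω := by
  unfold coinIndicator; split_ifs <;> norm_num

theorem coinIndicator_le_one {V : Type*} (B : Finset (Finset V)) (ω : Finset V → Bool) :
    coinIndicator B ω ≤ 1 := by
  unfold coinIndicator; split_ifs <;> norm_num

theorem coinIndicator_mul {V : Type*} [DecidableEq V] (B B' : Finset (Finset V))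
    (ω : Finset V → Bool) :
    coinIndicator B ω * coinIndicator B' ω = coinIndicator (B ∪ B') ω := by
  unfold coinIndicator
  simp only [Finset.mem_union, or_imp, forall_and]
  split_ifs <;> simp_all

instance (n : ℕ) (p : ℕ → unitInterval) : IsProbabilityMeasure (coinMeasure n p) := by
  unfold coinMeasure; infer_instance

theorem integral_coinIndicator {n : ℕ} (p : ℕ → unitInterval) (B : Finset (Finset (Fin n))) :
    ∫ ω, coinIndicator B ω ∂coinMeasure n p = faceWeight p B := by
  classical
  have h1 : ∀ ω : Finset (Fin n) → Bool, coinIndicator B ω =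
      ({ω | ∀ T ∈ B, ω T = true} : Set (Finset (Fin n) → Bool)).indicator 1 ω := by
    intro ω
    simp [coinIndicator, Set.indicator_apply]
  simp only [h1]
  rw [integral_indicator_one (MeasurableSet.of_discrete)]
  have h2 : ({ω | ∀ T ∈ B, ω T = true} : Set (Finset (Fin n) → Bool)) =
      Set.univ.pi fun T => if T ∈ B then {true} else Set.univ := by
    ext ω
    simp only [Set.mem_ofPred_eq, Set.mem_pi, Set.mem_univ, true_imp_iff]
    refine forall_congr' fun T => ?_
    split_ifs with h <;> simp [h]
  rw [h2, coinMeasure, measureReal_def, Measure.pi_pi, ENNReal.toReal_prod]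
  unfold faceWeight
  rw [← Finset.prod_subset (Finset.subset_univ B)]
  · refine Finset.prod_congr rfl fun T hT => ?_
    rw [if_pos hT]
    change (bernoulliMeasure true false (p (T.card - 1))).real {true} = _
    rw [bernoulliMeasure_real_apply _ MeasurableSet.of_discrete]
    simp
  · intro T _ hT
    rw [if_neg hT]
    simp

theorem integrable_coin {n : ℕ} (p : ℕ → unitInterval) (F : (Finset (Fin n) → Bool) → ℝ) :
    Integrable F (coinMeasure n p) := Integrable.of_finite

theorem meanOrdered_simplex_eq_sum (n k : ℕ) (p : ℕ → unitInterval) :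
    meanOrdered n p (simplex k) =
      ∑ f : Fin (k + 1) ↪ Fin n, faceWeight p (faceSet (Finset.univ.map f)) := by
  unfold meanOrdered
  simp only [orderedCount_simplex]
  rw [integral_finsetSum _ fun f _ => integrable_coin p _]
  simp only [integral_coinIndicator]

/-! ### The two bounds on the tail: moments and planting -/

theorem card_faceSet_le {V : Type*} (S : Finset V) : (faceSet S).card ≤ 2 ^ S.card :=
  (Finset.card_filter_le _ _).trans (Finset.card_powerset S).le

theorem faceWeight_union {V : Type*} [DecidableEq V] (p : ℕ → unitInterval)
    (B B' : Finset (Finset V)) :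
    faceWeight p (B ∪ B') = faceWeight p B * faceWeight p (B' \ B) := by
  unfold faceWeight
  rw [← Finset.union_sdiff_self_eq_union, Finset.prod_union Finset.disjoint_sdiff]

/-- If the expected number of ordered simplices, conditionally on any few simplices being
present, is at most `A`, then so are the normalised moments. -/
theorem moment_le {n k M : ℕ} (p : ℕ → unitInterval) {A : ℝ} (hA : 0 ≤ A)
    (h : ∀ B : Finset (Finset (Fin n)), B.card ≤ M * 2 ^ (k + 1) →
      ∑ f : Fin (k + 1) ↪ Fin n, faceWeight p (faceSet (Finset.univ.map f) \ B) ≤ A) :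
    ∫ ω, (orderedCount n (simplex k) ω : ℝ) ^ M ∂coinMeasure n p ≤ A ^ M := by
  -- Here j counts the factors already expanded; each of them adds the at most 2^(k+1) faces of one
  -- simplex to B.
  have key : ∀ (m j : ℕ) (B : Finset (Finset (Fin n))), B.card ≤ j * 2 ^ (k + 1) → j + m ≤ M →
      ∫ ω, coinIndicator B ω * (orderedCount n (simplex k) ω : ℝ) ^ m ∂coinMeasure n p
        ≤ faceWeight p B * A ^ m := by
    intro m
    induction m with
    | zero =>
      intro j B _ _
      simp [integral_coinIndicator]
    | succ m ih =>
      intro j B hB hj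
      have h1 : ∀ ω : Finset (Fin n) → Bool,
          coinIndicator B ω * (orderedCount n (simplex k) ω : ℝ) ^ (m + 1) =
          ∑ f : Fin (k + 1) ↪ Fin n, coinIndicator (B ∪ faceSet (Finset.univ.map f)) ω *
            (orderedCount n (simplex k) ω : ℝ) ^ m := by
        intro ω
        rw [pow_succ', ← Finset.sum_mul]
        simp only [← coinIndicator_mul]
        rw [← Finset.mul_sum, ← orderedCount_simplex]
        ring
      simp only [h1]
      rw [integral_finsetSum _ fun f _ => integrable_coin p _]
      calc _ ≤ ∑ f : Fin (k + 1) ↪ Fin n,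
            faceWeight p (B ∪ faceSet (Finset.univ.map f)) * A ^ m := by
            refine Finset.sum_le_sum fun f _ => ih (j + 1) _ ?_ (by omega)
            refine (Finset.card_union_le _ _).trans ?_
            have := card_faceSet_le (Finset.univ.map f)
            rw [Finset.card_map, Finset.card_univ, Fintype.card_fin] at this
            rw [add_mul, one_mul]
            omega
        _ = faceWeight p B * A ^ m *
            ∑ f : Fin (k + 1) ↪ Fin n, faceWeight p (faceSet (Finset.univ.map f) \ B) := by
            simp only [faceWeight_union]
            rw [Finset.mul_sum]
            exact Finset.sum_congr rfl fun f _ => by ring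
        _ ≤ faceWeight p B * A ^ m * A := by
            refine mul_le_mul_of_nonneg_left (h B (hB.trans ?_))
              (mul_nonneg (faceWeight_nonneg _ _) (pow_nonneg hA _))
            exact Nat.mul_le_mul_right _ (by omega)
        _ = _ := by ring
  have := key M 0 ∅ (by simp) (by omega)
  simpa [coinIndicator, faceWeight] using this

/-- Markov's inequality for the M-th power of the count. -/
theorem upperTail_le {n k M : ℕ} (p : ℕ → unitInterval) {ε δ : ℝ} (hε : 0 < ε) (hδ : 0 ≤ δ)
    (hμ : 0 < meanOrdered n p (simplex k))
    (h : ∀ B : Finset (Finset (Fin n)), B.card ≤ M * 2 ^ (k + 1) →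
      ∑ f : Fin (k + 1) ↪ Fin n, faceWeight p (faceSet (Finset.univ.map f) \ B)
        ≤ (1 + δ) * meanOrdered n p (simplex k)) :
    upperTail n p (simplex k) ε ≤ ((1 + δ) / (1 + ε)) ^ M := by
  set μ := meanOrdered n p (simplex k)
  have hpos : 0 < (1 + ε) * μ := by positivity
  have hm := moment_le p (by positivity) h
  have hM := mul_meas_ge_le_integral_of_nonneg (μ := coinMeasure n p)
    (f := fun ω => (orderedCount n (simplex k) ω : ℝ) ^ M)
    (ae_of_all _ fun ω => by positivity) (integrable_coin p _) (((1 + ε) * μ) ^ M)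
  have hsub : upperTail n p (simplex k) ε ≤ (coinMeasure n p).real
      {ω | ((1 + ε) * μ) ^ M ≤ (orderedCount n (simplex k) ω : ℝ) ^ M} := by
    refine measureReal_mono fun ω hω => ?_
    exact pow_le_pow_left₀ hpos.le hω M
  have h3 : upperTail n p (simplex k) ε * ((1 + ε) * μ) ^ M ≤ ((1 + δ) * μ) ^ M := by
    refine le_trans ?_ (hM.trans hm)
    rw [mul_comm]
    exact mul_le_mul_of_nonneg_left hsub (by positivity)
  rw [div_pow, le_div_iff₀ (by positivity)]
  rw [mul_pow, mul_pow, ← mul_assoc] at h3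
  exact le_of_mul_le_mul_right h3 (by positivity)

/-- A lower bound for the upper tail from planting the simplices of `B`. -/
theorem le_upperTail {n k : ℕ} (p : ℕ → unitInterval) {ε : ℝ} (B : Finset (Finset (Fin n)))
    (hB : 2 * ((1 + ε) * meanOrdered n p (simplex k)) ≤
      ∑ f : Fin (k + 1) ↪ Fin n, faceWeight p (faceSet (Finset.univ.map f) \ B)) :
    faceWeight p B * ((1 + ε) * meanOrdered n p (simplex k)) ≤
      (n : ℝ) ^ (k + 1) * upperTail n p (simplex k) ε := by
  classical
  set μ := meanOrdered n p (simplex k)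
  set E : Set (Finset (Fin n) → Bool) := {ω | (1 + ε) * μ ≤ (orderedCount n (simplex k) ω : ℝ)}
  have h1 : ∫ ω, coinIndicator B ω * (orderedCount n (simplex k) ω : ℝ) ∂coinMeasure n p =
      faceWeight p B *
        ∑ f : Fin (k + 1) ↪ Fin n, faceWeight p (faceSet (Finset.univ.map f) \ B) := by
    simp only [orderedCount_simplex, Finset.mul_sum, coinIndicator_mul]
    rw [integral_finsetSum _ fun f _ => integrable_coin p _]
    simp only [integral_coinIndicator, faceWeight_union]
  have hN : ∀ ω, (orderedCount n (simplex k) ω : ℝ) ≤ (n : ℝ) ^ (k + 1) := by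
    intro ω
    rw [orderedCount_simplex]
    refine (Finset.sum_le_sum fun f _ => coinIndicator_le_one _ _).trans ?_
    simp only [Finset.sum_const, Finset.card_univ, Fintype.card_embedding_eq, Fintype.card_fin,
      nsmul_eq_mul, mul_one]
    exact_mod_cast Nat.descFactorial_le_pow n (k + 1)
  -- No sign is assumed for ε; a negative threshold makes the left side nonpositive.
  by_cases hμ : 0 ≤ (1 + ε) * μ
  · have h2 : ∫ ω, coinIndicator B ω * (orderedCount n (simplex k) ω : ℝ) ∂coinMeasure n p ≤
      ∫ ω, (((1 + ε) * μ) * coinIndicator B ω + (n : ℝ) ^ (k + 1) * E.indicator 1 ω)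
        ∂coinMeasure n p := by
      refine integral_mono (integrable_coin p _) (integrable_coin p _) fun ω => ?_
      have i0 := coinIndicator_nonneg B ω
      have i1 := coinIndicator_le_one B ω
      by_cases hω : ω ∈ E
      · simp only [Set.indicator_of_mem hω, Pi.one_apply, mul_one]
        have : coinIndicator B ω * (orderedCount n (simplex k) ω : ℝ) ≤ 1 * (n : ℝ) ^ (k + 1) :=
          mul_le_mul i1 (hN ω) (by positivity) zero_le_one
        have := mul_nonneg hμ i0
        linarith
      · simp only [Set.indicator_of_notMem hω, mul_zero, add_zero]
        rw [mul_comm]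
        exact mul_le_mul_of_nonneg_right (not_le.mp hω).le i0
    rw [integral_add (integrable_coin p _) (integrable_coin p _), integral_const_mul,
      integral_const_mul, integral_coinIndicator, integral_indicator_one MeasurableSet.of_discrete,
      h1] at h2
    -- Outcomes below the threshold account for at most one of the two multiples of the threshold in
    -- `hB`; the other must come from the tail event.
    have h3 := mul_le_mul_of_nonneg_left hB (faceWeight_nonneg p B)
    change _ ≤ _ + (n : ℝ) ^ (k + 1) * upperTail n p (simplex k) ε at h2
    linarith
  · refine (mul_nonpos_of_nonneg_of_nonpos (faceWeight_nonneg p B) (not_le.mp hμ).le).trans ?_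
    unfold upperTail
    positivity

/-! ### Finner's inequality and counting maps -/

/-- Hölder's inequality, with the missing weight given to the constant function 1, whose integral is
1 for a probability measure. -/
theorem lintegral_prod_rpow_le_of_sum_le_one {Ω J : Type*} [MeasurableSpace Ω] {μ : Measure Ω}
    [IsProbabilityMeasure μ] (s : Finset J) {f : J → Ω → ℝ≥0∞} (hf : ∀ j ∈ s, AEMeasurable (f j) μ)
    {w : J → ℝ} (hw : ∀ j ∈ s, 0 ≤ w j) (hs : ∑ j ∈ s, w j ≤ 1) :
    ∫⁻ a, ∏ j ∈ s, f j a ^ w j ∂μ ≤ ∏ j ∈ s, (∫⁻ a, f j a ∂μ) ^ w j := by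
  have h := ENNReal.lintegral_prod_norm_pow_le (μ := μ) (Finset.insertNone s)
    (f := fun o a => o.elim 1 fun j => f j a)
    (p := fun o => o.elim (1 - ∑ j ∈ s, w j) w) ?_ ?_ ?_
  · simpa [Finset.prod_insertNone] using h
  · rintro (_ | j) hj
    · exact aemeasurable_const
    · exact hf j (by simpa using hj)
  · simp [Finset.sum_insertNone]
  · rintro (_ | j) hj
    · simpa using hs
    · exact hw j (by simpa using hj)

/-- Finner's inequality, for marginals. -/
theorem lmarginal_prod_rpow_le {ι V J : Type*} [DecidableEq ι] [MeasurableSpace V] (μ : Measure V)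
    [IsProbabilityMeasure μ] (s : Finset J) (T : J → Finset ι) {w : J → ℝ}
    (hw : ∀ j ∈ s, 0 ≤ w j) (hs : ∀ v, ∑ j ∈ s with v ∈ T j, w j ≤ 1)
    {g : J → (ι → V) → ℝ≥0∞} (hg : ∀ j, Measurable (g j))
    (hdep : ∀ j x y, (∀ i ∈ T j, x i = y i) → g j x = g j y) (A : Finset ι) (x : ι → V) :
    (∫⋯∫⁻_A, (fun x => ∏ j ∈ s, g j x ^ w j) ∂fun _ => μ) x ≤
      ∏ j ∈ s, ((∫⋯∫⁻_A, g j ∂fun _ => μ) x) ^ w j := by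
  have hG : Measurable fun x => ∏ j ∈ s, g j x ^ w j :=
    Finset.measurable_fun_prod _ fun j _ => (hg j).pow_const _
  induction A using Finset.induction generalizing x with
  | empty => simp
  | insert v A hv ih =>
    rw [lmarginal_insert _ hG hv]
    -- The factors that do not see the coordinate v come out of the integral over it; Hölder applies
    -- to the others, whose weights sum to at most 1.
    have hconst : ∀ j, v ∉ T j → ∀ y, (∫⋯∫⁻_A, g j ∂fun _ => μ) (Function.update x v y) =
        (∫⋯∫⁻_A, g j ∂fun _ => μ) x := by
      intro j hj y
      rw [lmarginal_update_of_notMem (hg j) hv]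
      congr 1
      funext z
      refine hdep j _ _ fun i hi => ?_
      refine Function.update_of_ne ?_ _ _
      rintro rfl
      exact hj hi
    calc _ ≤ ∫⁻ y, ∏ j ∈ s, ((∫⋯∫⁻_A, g j ∂fun _ => μ) (Function.update x v y)) ^ w j ∂μ :=
          lintegral_mono fun y => ih _
      _ = ∫⁻ y, (∏ j ∈ s with ¬ v ∈ T j, ((∫⋯∫⁻_A, g j ∂fun _ => μ) x) ^ w j) *
            ∏ j ∈ s with v ∈ T j,
              ((∫⋯∫⁻_A, g j ∂fun _ => μ) (Function.update x v y)) ^ w j ∂μ := by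
          refine lintegral_congr fun y => ?_
          rw [← Finset.prod_filter_mul_prod_filter_not s (fun j => v ∈ T j), mul_comm]
          congr 1
          refine Finset.prod_congr rfl fun j hj => ?_
          rw [hconst j (Finset.mem_filter.mp hj).2]
      _ = (∏ j ∈ s with ¬ v ∈ T j, ((∫⋯∫⁻_A, g j ∂fun _ => μ) x) ^ w j) *
            ∫⁻ y, ∏ j ∈ s with v ∈ T j,
              ((∫⋯∫⁻_A, g j ∂fun _ => μ) (Function.update x v y)) ^ w j ∂μ := by
          refine lintegral_const_mul _ (Finset.measurable_fun_prod _ fun j _ => ?_)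
          exact (((hg j).lmarginal _).comp (measurable_update x)).pow_const _
      _ ≤ (∏ j ∈ s with ¬ v ∈ T j, ((∫⋯∫⁻_A, g j ∂fun _ => μ) x) ^ w j) *
            ∏ j ∈ s with v ∈ T j,
              (∫⁻ y, (∫⋯∫⁻_A, g j ∂fun _ => μ) (Function.update x v y) ∂μ) ^ w j := by
          gcongr
          refine lintegral_prod_rpow_le_of_sum_le_one _ (fun j _ => ?_)
            (fun j hj => hw j (Finset.mem_filter.mp hj).1) (hs v)
          exact (((hg j).lmarginal _).comp (measurable_update x)).aemeasurable
      _ = _ := by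
          rw [← Finset.prod_filter_mul_prod_filter_not s (fun j => v ∈ T j), mul_comm]
          congr 1
          · refine Finset.prod_congr rfl fun j _ => ?_
            rw [lmarginal_insert _ (hg j) hv]
          · refine Finset.prod_congr rfl fun j hj => ?_
            rw [lmarginal_insert _ (hg j) hv]
            simp [hconst j (Finset.mem_filter.mp hj).2]

/-- Finner's inequality for finite sums. -/
theorem sum_prod_rpow_le {ι V J : Type*} [Fintype ι] [DecidableEq ι] [Fintype V] [Nonempty V]
    (s : Finset J) (T : J → Finset ι) {w : J → ℝ}
    (hw : ∀ j ∈ s, 0 ≤ w j) (hs : ∀ v, ∑ j ∈ s with v ∈ T j, w j ≤ 1)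
    {g : J → (ι → V) → ℝ} (hg : ∀ j x, 0 ≤ g j x)
    (hdep : ∀ j x y, (∀ i ∈ T j, x i = y i) → g j x = g j y)
    {b : J → ℝ} (hb : ∀ j ∈ s, ∑ x, g j x ≤ (Fintype.card V : ℝ) ^ Fintype.card ι * b j) :
    ∑ x, ∏ j ∈ s, g j x ^ w j ≤ (Fintype.card V : ℝ) ^ Fintype.card ι * ∏ j ∈ s, b j ^ w j := by
  classical
  let _ : MeasurableSpace V := ⊤
  -- Dividing by the number of maps turns the sums into integrals against the uniform product
  -- measure.
  let μ : Measure V := (PMF.uniformOfFintype V).toMeasure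
  have hN : (0 : ℝ) < (Fintype.card V : ℝ) ^ Fintype.card ι := by
    have := Fintype.card_pos (α := V)
    positivity
  have hb0 : ∀ j ∈ s, 0 ≤ b j := fun j hj =>
    nonneg_of_mul_nonneg_right ((Finset.sum_nonneg fun x _ => hg j x).trans (hb j hj)) hN
  have hint : ∀ F : (ι → V) → ℝ, (∀ x, 0 ≤ F x) →
      ∫⁻ x, ENNReal.ofReal (F x) ∂Measure.pi (fun _ : ι => μ) =
        ENNReal.ofReal ((∑ x, F x) / (Fintype.card V : ℝ) ^ Fintype.card ι) := by
    intro F hF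
    rw [lintegral_fintype, Finset.sum_div, ENNReal.ofReal_sum_of_nonneg fun x _ => by
      have := hF x; positivity]
    refine Finset.sum_congr rfl fun x _ => ?_
    rw [Measure.pi_singleton, div_eq_mul_inv, ENNReal.ofReal_mul (hF x)]
    congr 1
    simp only [μ, PMF.toMeasure_apply_singleton _ _ (measurableSet_singleton _),
      PMF.uniformOfFintype_apply, Finset.prod_const, Finset.card_univ]
    rw [ENNReal.ofReal_inv_of_pos hN, ENNReal.ofReal_pow (by positivity), ENNReal.ofReal_natCast,
      ENNReal.inv_pow]
  have hx : Nonempty (ι → V) := inferInstance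
  obtain ⟨x0⟩ := hx
  have key := lmarginal_prod_rpow_le μ s T hw hs (g := fun j x => ENNReal.ofReal (g j x))
    (fun j => Measurable.of_discrete) (fun j x y h => by rw [hdep j x y h]) Finset.univ x0
  simp only [lmarginal_univ] at key
  have e1 : ∀ x, ∏ j ∈ s, ENNReal.ofReal (g j x) ^ w j =
      ENNReal.ofReal (∏ j ∈ s, g j x ^ w j) := by
    intro x
    rw [ENNReal.ofReal_prod_of_nonneg fun j _ => Real.rpow_nonneg (hg j x) _]
    exact Finset.prod_congr rfl fun j hj => ENNReal.ofReal_rpow_of_nonneg (hg j x) (hw j hj)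
  simp only [e1] at key
  rw [hint _ fun x => Finset.prod_nonneg fun j _ => Real.rpow_nonneg (hg j x) _] at key
  simp only [hint _ (hg _)] at key
  have h2 : ∏ j ∈ s, ENNReal.ofReal ((∑ x, g j x) / (Fintype.card V : ℝ) ^ Fintype.card ι) ^ w j ≤
      ENNReal.ofReal (∏ j ∈ s, b j ^ w j) := by
    rw [ENNReal.ofReal_prod_of_nonneg fun j hj => Real.rpow_nonneg (hb0 j hj) _]
    refine Finset.prod_le_prod' fun j hj => ?_
    rw [← ENNReal.ofReal_rpow_of_nonneg (hb0 j hj) (hw j hj)]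
    refine ENNReal.rpow_le_rpow (ENNReal.ofReal_le_ofReal ?_) (hw j hj)
    rw [div_le_iff₀ hN, mul_comm]
    exact hb j hj
  have h3 := (ENNReal.ofReal_le_ofReal_iff
    (Finset.prod_nonneg fun j hj => Real.rpow_nonneg (hb0 j hj) _)).mp (key.trans h2)
  rw [div_le_iff₀ hN] at h3
  linarith

/-- Once the image b is chosen from B, the coordinates in T take values in b, which has at most |T|
elements, and the remaining coordinates are free. -/
theorem card_image_mem_le {ι V : Type*} [Fintype ι] [DecidableEq ι] [Fintype V] [DecidableEq V]
    (T : Finset ι) (B : Finset (Finset V)) :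
    (Finset.univ.filter fun x : ι → V => T.image x ∈ B).card ≤
      B.card * (T.card ^ T.card * Fintype.card V ^ (Fintype.card ι - T.card)) := by
  have h : (Finset.univ.filter fun x : ι → V => T.image x ∈ B) ⊆
      B.biUnion fun b => Finset.univ.filter fun x : ι → V => T.image x = b := by
    intro x hx
    simpa using hx
  refine (Finset.card_le_card h).trans (Finset.card_biUnion_le_card_mul _ _ _ fun b _ => ?_)
  by_cases hb : b.card ≤ T.card
  · have h2 : (Finset.univ.filter fun x : ι → V => T.image x = b) ⊆
        Fintype.piFinset fun i => if i ∈ T then b else Finset.univ := by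
      intro x hx
      simp only [Finset.mem_filter, Finset.mem_univ, true_and] at hx
      rw [Fintype.mem_piFinset]
      intro i
      split_ifs with hi
      · rw [← hx]; exact Finset.mem_image_of_mem x hi
      · exact Finset.mem_univ _
    refine (Finset.card_le_card h2).trans ?_
    rw [Fintype.card_piFinset]
    simp only [apply_ite Finset.card, Finset.card_univ]
    rw [Finset.prod_ite, Finset.prod_const, Finset.prod_const]
    have e1 : (Finset.univ.filter fun i => i ∈ T) = T := by ext; simp
    have e2 : (Finset.univ.filter fun i => i ∉ T).card = Fintype.card ι - T.card := by
      rw [← Finset.card_compl]; congr 1; ext; simp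
    rw [e1, e2]
    gcongr
  · rw [Finset.filter_eq_empty_iff.mpr, Finset.card_empty]
    · exact Nat.zero_le _
    · rintro x - rfl
      exact hb Finset.card_image_le

/-! ### The exponents -/

/-- The exponent `∑_{j=q}^{k₀} (k+1 choose j+1) a_j`. -/
def weightExponent (k q : ℕ) (a : ℕ → ℝ) (k₀ : ℕ) : ℝ :=
  ∑ j ∈ Finset.Icc q k₀, ((k + 1).choose (j + 1) : ℝ) * a j

/-- Group the faces by dimension; dimensions below q contribute nothing because their exponents
vanish. -/
theorem sum_faceSet_card_le {k q : ℕ} (hq : 1 ≤ q) {a : ℕ → ℝ}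
    (ha : ∀ j, 1 ≤ j → j < q → a j = 0) (k₀ : ℕ) :
    ∑ T ∈ faceSet (Finset.univ : Finset (Fin (k + 1))) with T.card ≤ k₀ + 1, a (T.card - 1) =
      weightExponent k q a k₀ := by
  have h1 : ∀ T ∈ (faceSet (Finset.univ : Finset (Fin (k + 1)))).filter (·.card ≤ k₀ + 1),
      T.card - 1 ∈ Finset.Icc 1 k₀ := by
    intro T hT
    rw [Finset.mem_filter, mem_faceSet] at hT
    rw [Finset.mem_Icc]
    omega
  rw [← Finset.sum_fiberwise_of_maps_to h1]
  have h2 : ∀ j ∈ Finset.Icc 1 k₀,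
      ∑ T ∈ (faceSet (Finset.univ : Finset (Fin (k + 1)))).filter (·.card ≤ k₀ + 1)
        with T.card - 1 = j, a (T.card - 1) = ((k + 1).choose (j + 1) : ℝ) * a j := by
    intro j hj
    rw [Finset.mem_Icc] at hj
    rw [Finset.sum_congr rfl (g := fun _ => a j) (fun T hT => by rw [(Finset.mem_filter.mp hT).2]),
      Finset.sum_const, nsmul_eq_mul]
    congr 2
    have : ((faceSet (Finset.univ : Finset (Fin (k + 1)))).filter (·.card ≤ k₀ + 1)).filter
        (fun T => T.card - 1 = j) = Finset.powersetCard (j + 1) Finset.univ := by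
      ext T
      simp only [Finset.mem_filter, mem_faceSet, Finset.mem_powersetCard, Finset.subset_univ,
        true_and]
      omega
    rw [this, Finset.card_powersetCard, Finset.card_univ, Fintype.card_fin]
  rw [Finset.sum_congr rfl h2, weightExponent]
  symm
  refine Finset.sum_subset (Finset.Icc_subset_Icc_left hq) fun j hj hj' => ?_
  rw [Finset.mem_Icc] at hj hj'
  rw [ha j hj.1 (by omega), mul_zero]

theorem Subcritical.one_le {k q : ℕ} {α : ℕ → ℝ≥0∞} (h : Subcritical k q α) : 1 ≤ q := h.2.1.1.1

theorem Subcritical.ne_top {k q : ℕ} {α : ℕ → ℝ≥0∞} (h : Subcritical k q α) {j : ℕ} (h1 : 1 ≤ j)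
    (h2 : j ≤ k) : α j ≠ ⊤ := by
  intro ht
  have hle := (Finset.single_le_sum (f := fun i => (k.choose i : ℝ≥0∞) * α i)
    (fun i _ => zero_le) (Finset.mem_Icc.mpr ⟨h1, h2⟩)).trans_lt h.1
  simp only [ht] at hle
  rw [ENNReal.mul_top (by exact_mod_cast (Nat.choose_pos h2).ne')] at hle
  exact absurd hle (by simp)

theorem Subcritical.sum_toReal_lt {k q : ℕ} {α : ℕ → ℝ≥0∞} (h : Subcritical k q α) :
    ∑ i ∈ Finset.Icc 1 k, (k.choose i : ℝ) * (α i).toReal < 1 := by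
  have h1 := (ENNReal.toReal_lt_toReal (h.1.trans ENNReal.one_lt_top).ne ENNReal.one_ne_top).mpr h.1
  rw [ENNReal.toReal_sum] at h1
  · simpa using h1
  · intro i hi
    rw [Finset.mem_Icc] at hi
    exact ENNReal.mul_ne_top (ENNReal.natCast_ne_top _) (h.ne_top hi.1 hi.2)

theorem Subcritical.toReal_pos {k q : ℕ} {α : ℕ → ℝ≥0∞} (h : Subcritical k q α) :
    0 < (α q).toReal :=
  ENNReal.toReal_pos h.2.1.1.2.ne' (h.ne_top h.one_le h.2.2)

theorem Subcritical.toReal_eq_zero {k q : ℕ} {α : ℕ → ℝ≥0∞} (h : Subcritical k q α) {j : ℕ}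
    (h1 : 1 ≤ j) (h2 : j < q) : (α j).toReal = 0 := by
  by_contra hne
  have : 0 < α j := pos_iff_ne_zero.mpr fun h0 => hne (by rw [h0]; rfl)
  exact absurd (h.2.1.2 ⟨h1, this⟩) (not_le.mpr h2)

theorem Subcritical.choose_mul_lt {k q : ℕ} {α : ℕ → ℝ≥0∞} (h : Subcritical k q α) :
    (k.choose q : ℝ) * (α q).toReal < 1 :=
  (Finset.single_le_sum (f := fun i => (k.choose i : ℝ) * (α i).toReal)
    (fun i _ => by positivity) (Finset.mem_Icc.mpr ⟨h.one_le, h.2.2⟩)).trans_lt h.sum_toReal_lt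

theorem Subcritical.toReal_lt_one {k q : ℕ} {α : ℕ → ℝ≥0∞} (h : Subcritical k q α) :
    (α q).toReal < 1 := by
  refine lt_of_le_of_lt ?_ h.choose_mul_lt
  have : (1 : ℝ) ≤ k.choose q := by exact_mod_cast Nat.choose_pos h.2.2
  nlinarith [h.toReal_pos]

/-- A crude bound from C(k+1,j+1) ≤ (k+1)C(k,j). It is only used to see that μ is at least a fixed
negative power of n. -/
theorem Subcritical.weightExponent_le {k q : ℕ} {α : ℕ → ℝ≥0∞} (h : Subcritical k q α) :
    weightExponent k q (fun j => (α j).toReal) k ≤ k + 1 := by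
  calc weightExponent k q (fun j => (α j).toReal) k
      ≤ ∑ j ∈ Finset.Icc 1 k, ((k + 1).choose (j + 1) : ℝ) * (α j).toReal :=
        Finset.sum_le_sum_of_subset_of_nonneg (Finset.Icc_subset_Icc_left h.one_le)
          fun j _ _ => by positivity
    _ ≤ ∑ j ∈ Finset.Icc 1 k, ((k : ℝ) + 1) * ((k.choose j : ℝ) * (α j).toReal) := by
        refine Finset.sum_le_sum fun j _ => ?_
        rw [← mul_assoc]
        refine mul_le_mul_of_nonneg_right ?_ ENNReal.toReal_nonneg
        have h2 : (((k + 1) * k.choose j : ℕ) : ℝ) = ((k + 1).choose (j + 1) * (j + 1) : ℕ) := by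
          rw [Nat.add_one_mul_choose_eq]
        push_cast at h2
        rw [h2]
        nlinarith [Nat.cast_nonneg (α := ℝ) ((k + 1).choose (j + 1)), Nat.cast_nonneg (α := ℝ) j]
    _ ≤ _ := by
        rw [← Finset.mul_sum]
        nlinarith [h.sum_toReal_lt, Nat.cast_nonneg (α := ℝ) k]

/-- The coefficient of α_q in the extra condition equals C(k+1,q+1) - C(k,q). Hence the condition
says that growth times the largest gain from faces of dimension at most k₀ is of smaller order than
n^{k₀+1}. -/
theorem ExtraCondition.weightExponent_lt {k q : ℕ} {α : ℕ → ℝ≥0∞} (h : ExtraCondition k q α)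
    {k₀ : ℕ} (h1 : q < k₀) (h2 : k₀ ≤ k) :
    (q : ℝ) + 1 - (k.choose q : ℝ) * (α q).toReal +
      weightExponent k q (fun j => (α j).toReal) k₀ < k₀ + 1 := by
  have h3 := h k₀ h1 h2
  have h4 : (((k + 1) * k.choose q : ℕ) : ℝ) = ((k + 1).choose (q + 1) * (q + 1) : ℕ) := by
    rw [Nat.add_one_mul_choose_eq]
  push_cast at h4
  have hk : (0 : ℝ) < k + 1 := by positivity
  have h5 : ((k : ℝ) - q) / ((k : ℝ) + 1) * ((k + 1).choose (q + 1) : ℝ) =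
      ((k + 1).choose (q + 1) : ℝ) - k.choose q := by
    field_simp
    linear_combination h4
  rw [h5] at h3
  have h6 : Finset.Icc q k₀ = insert q (Finset.Icc (q + 1) k₀) := by
    ext j; simp only [Finset.mem_insert, Finset.mem_Icc]; omega
  rw [weightExponent, h6, Finset.sum_insert (by simp)]
  linarith

/-! ### Powers of n for large n -/

theorem growth_pos {k q n : ℕ} {α : ℕ → ℝ≥0∞} (hn : 0 < n) : 0 < growth k q α n :=
  Real.rpow_pos_of_pos (by exact_mod_cast hn) _

theorem tendsto_natCast_rpow_atTop {y : ℝ} (hy : 0 < y) :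
    Tendsto (fun n : ℕ => (n : ℝ) ^ y) atTop atTop :=
  (tendsto_rpow_atTop hy).comp tendsto_natCast_atTop_atTop

theorem eventually_growth_mul_le {k q : ℕ} {α : ℕ → ℝ≥0∞} (h : ExtraCondition k q α) {η : ℝ}
    (hη : 0 < η) :
    ∀ᶠ n : ℕ in atTop, ∀ k₀, q < k₀ → k₀ ≤ k →
      growth k q α n * (n : ℝ) ^ weightExponent k q (fun j => (α j).toReal) k₀ ≤
        η * (n : ℝ) ^ (k₀ + 1) := by
  have h1 : ∀ k₀ ∈ Finset.Ioc q k, ∀ᶠ n : ℕ in atTop,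
      growth k q α n * (n : ℝ) ^ weightExponent k q (fun j => (α j).toReal) k₀ ≤
        η * (n : ℝ) ^ (k₀ + 1) := by
    intro k₀ hk₀
    rw [Finset.mem_Ioc] at hk₀
    have hlt := h.weightExponent_lt hk₀.1 hk₀.2
    filter_upwards [(tendsto_natCast_rpow_atTop (sub_pos.mpr hlt)).eventually_ge_atTop η⁻¹,
      eventually_gt_atTop 0] with n hn hn0
    have hn' : (0 : ℝ) < n := by exact_mod_cast hn0
    rw [growth, ← Real.rpow_add hn']
    rw [Real.rpow_sub hn', le_div_iff₀ (Real.rpow_pos_of_pos hn' _), ← div_eq_inv_mul,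
      div_le_iff₀ hη] at hn
    refine hn.trans (le_of_eq ?_)
    rw [mul_comm, ← Real.rpow_natCast]
    norm_num
  rw [← Finset.eventually_all] at h1
  filter_upwards [h1] with n hn k₀ hq hk
  exact hn k₀ (Finset.mem_Ioc.mpr ⟨hq, hk⟩)

theorem coe_powProb {n : ℕ} {a : ℝ≥0∞} (ha : a ≠ ⊤) :
    (powProb n a : ℝ) = (n : ℝ) ^ (-a.toReal) := by
  simp [powProb, ha]

theorem Subcritical.faceWeight_eq {V : Type*} {k q : ℕ} {α : ℕ → ℝ≥0∞} (h : Subcritical k q α)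
    {n : ℕ} (hn : 0 < n) {B : Finset (Finset V)} (hB : ∀ T ∈ B, 2 ≤ T.card ∧ T.card ≤ k + 1) :
    faceWeight (fun i => powProb n (α i)) B =
      (n : ℝ) ^ (-∑ T ∈ B, (α (T.card - 1)).toReal) := by
  have hn' : (0 : ℝ) < n := by exact_mod_cast hn
  rw [← Finset.sum_neg_distrib, Real.rpow_sum_of_pos hn']
  refine Finset.prod_congr rfl fun T hT => ?_
  have := hB T hT
  exact coe_powProb (h.ne_top (by omega) (by omega))

theorem tendsto_descFactorial_div_pow (m : ℕ) :
    Tendsto (fun n : ℕ => (n.descFactorial m : ℝ) / (n : ℝ) ^ m) atTop (nhds 1) := by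
  induction m with
  | zero => simp
  | succ m ih =>
    have h1 : Tendsto (fun n : ℕ => ((n - m : ℕ) : ℝ) / n) atTop (nhds 1) := by
      have h2 : Tendsto (fun n : ℕ => 1 - (m : ℝ) / n) atTop (nhds (1 - 0)) :=
        tendsto_const_nhds.sub (tendsto_const_div_atTop_nhds_zero_nat _)
      rw [sub_zero] at h2
      refine h2.congr' ?_
      filter_upwards [eventually_ge_atTop m, eventually_gt_atTop 0] with n hn hn0
      have hn' : (0 : ℝ) < n := by exact_mod_cast hn0
      rw [Nat.cast_sub hn]
      field_simp
    have := h1.mul ih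
    rw [one_mul] at this
    refine this.congr fun n => ?_
    rw [Nat.descFactorial_succ, pow_succ']
    push_cast
    rw [div_mul_div_comm]

theorem eventually_le_descFactorial (m : ℕ) {η : ℝ} (hη : 0 < η) :
    ∀ᶠ n : ℕ in atTop, (1 - η) * (n : ℝ) ^ m ≤ (n.descFactorial m : ℝ) := by
  filter_upwards [(tendsto_descFactorial_div_pow m).eventually_const_le
    (show 1 - η < 1 by linarith), eventually_gt_atTop 0] with n hn hn0
  have hn' : (0 : ℝ) < (n : ℝ) ^ m := by positivity
  exact (le_div_iff₀ hn').mp hn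

theorem card_filter_mem_powersetCard_le {ι : Type*} [Fintype ι] [DecidableEq ι] (v : ι) (q : ℕ) :
    ((Finset.powersetCard (q + 1) (Finset.univ : Finset ι)).filter fun T => v ∈ T).card ≤
      (Fintype.card ι - 1).choose q := by
  rw [← Finset.card_univ, ← Finset.card_erase_of_mem (Finset.mem_univ v),
    ← Finset.card_powersetCard]
  refine Finset.card_le_card_of_injOn (fun T => T.erase v) ?_ ?_
  · intro T hT
    simp only [Finset.coe_filter, Finset.mem_powersetCard, Set.mem_ofPred_eq] at hT
    rw [Finset.mem_coe, Finset.mem_powersetCard]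
    exact ⟨Finset.erase_subset_erase _ (Finset.subset_univ _),
      by rw [Finset.card_erase_of_mem hT.2, hT.1.2]; rfl⟩
  · intro T hT T' hT' he
    simp only [Finset.coe_filter, Set.mem_ofPred_eq] at hT hT'
    simp only at he
    rw [← Finset.insert_erase hT.2, ← Finset.insert_erase hT'.2, he]

/-! ### The conditional mean given few simplices -/

theorem faceSet_map {V W : Type*} (S : Finset V) (f : V ↪ W) :
    faceSet (S.map f) = (faceSet S).map (Finset.mapEmbedding f).toEmbedding := by
  ext T
  simp only [mem_faceSet, Finset.mem_map, RelEmbedding.coe_toEmbedding,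
    Finset.mapEmbedding_apply, Finset.subset_map_iff]
  constructor
  · rintro ⟨⟨U, hU, rfl⟩, h2⟩
    exact ⟨U, ⟨hU, by simpa using h2⟩, rfl⟩
  · rintro ⟨U, ⟨hU, h2⟩, rfl⟩
    exact ⟨⟨U, hU, rfl⟩, by simpa using h2⟩

theorem Subcritical.sum_faceSet_univ {k q : ℕ} {α : ℕ → ℝ≥0∞} (h : Subcritical k q α) :
    ∑ T ∈ faceSet (Finset.univ : Finset (Fin (k + 1))), (α (T.card - 1)).toReal =
      weightExponent k q (fun j => (α j).toReal) k := by
  rw [← sum_faceSet_card_le h.one_le (fun j => h.toReal_eq_zero) k]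
  refine Finset.sum_congr ?_ fun _ _ => rfl
  rw [Finset.filter_true_of_mem]
  intro T _
  simpa using Finset.card_le_univ T

/-- This separates the probability of a simplex from the gain due to its faces in B, which is the
only factor depending on the embedding. -/
theorem Subcritical.faceWeight_sdiff {k q : ℕ} {α : ℕ → ℝ≥0∞} (h : Subcritical k q α) {n : ℕ}
    (hn : 0 < n) (B : Finset (Finset (Fin n))) (f : Fin (k + 1) ↪ Fin n) :
    faceWeight (fun i => powProb n (α i)) (faceSet (Finset.univ.map f) \ B) =
      (n : ℝ) ^ (-weightExponent k q (fun j => (α j).toReal) k) *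
      (n : ℝ) ^ (∑ T ∈ faceSet (Finset.univ : Finset (Fin (k + 1))) with T.map f ∈ B,
        (α (T.card - 1)).toReal) := by
  have hn' : (0 : ℝ) < n := by exact_mod_cast hn
  rw [h.faceWeight_eq hn, ← Real.rpow_add hn']
  · congr 1
    rw [← h.sum_faceSet_univ, Finset.sdiff_eq_filter, faceSet_map, Finset.sum_filter,
      Finset.sum_map, ← Finset.sum_filter,
      ← Finset.sum_filter_add_sum_filter_not (faceSet Finset.univ) (fun T => T.map f ∈ B)]
    simp only [RelEmbedding.coe_toEmbedding, Finset.mapEmbedding_apply, Finset.card_map, neg_add]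
    rw [add_comm (-_) (-_), neg_add_cancel_right]
    congr 2
  · intro T hT
    rw [Finset.mem_sdiff, mem_faceSet] at hT
    exact ⟨hT.1.2, by simpa using Finset.card_le_card hT.1.1⟩

theorem Subcritical.meanOrdered_eq {k q : ℕ} {α : ℕ → ℝ≥0∞} (h : Subcritical k q α) {n : ℕ}
    (hn : 0 < n) :
    meanOrdered n (fun i => powProb n (α i)) (simplex k) =
      (n : ℝ) ^ (-weightExponent k q (fun j => (α j).toReal) k) * n.descFactorial (k + 1) := by
  rw [meanOrdered_simplex_eq_sum]
  have := fun f => h.faceWeight_sdiff hn ∅ f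
  simp only [Finset.sdiff_empty, Finset.notMem_empty, Finset.filter_false, Finset.sum_empty,
    Real.rpow_zero, mul_one] at this
  simp only [this, Finset.sum_const, Finset.card_univ, Fintype.card_embedding_eq,
    Fintype.card_fin, nsmul_eq_mul]
  ring

/-- The overlap of a simplex with `B` is governed by its `q`-faces in `B`, unless it has a face of
higher dimension in `B`. -/
theorem Subcritical.rpow_overlap_le {k q : ℕ} {α : ℕ → ℝ≥0∞} (h : Subcritical k q α) {n : ℕ}
    (hn : 0 < n) (B : Finset (Finset (Fin n))) (x : Fin (k + 1) → Fin n) :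
    (n : ℝ) ^ (∑ T ∈ faceSet (Finset.univ : Finset (Fin (k + 1))) with T.image x ∈ B,
        (α (T.card - 1)).toReal) ≤
      ∏ T ∈ Finset.powersetCard (q + 1) (Finset.univ : Finset (Fin (k + 1))),
        (if T.image x ∈ B then (n : ℝ) ^ ((k.choose q : ℝ) * (α q).toReal) else 1) ^
          ((k.choose q : ℝ)⁻¹) +
      ∑ T : Finset (Fin (k + 1)) with q + 2 ≤ T.card, if T.image x ∈ B then
        (n : ℝ) ^ weightExponent k q (fun j => (α j).toReal) (T.card - 1) else 0 := by
  have hn' : (0 : ℝ) < n := by exact_mod_cast hn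
  have hn1 : (1 : ℝ) ≤ n := by exact_mod_cast hn
  have hd : (k.choose q : ℝ) ≠ 0 := by exact_mod_cast (Nat.choose_pos h.2.2).ne'
  have hq := h.one_le
  have hprod : (0 : ℝ) ≤ ∏ T ∈ Finset.powersetCard (q + 1) (Finset.univ : Finset (Fin (k + 1))),
        (if T.image x ∈ B then (n : ℝ) ^ ((k.choose q : ℝ) * (α q).toReal) else 1) ^
          ((k.choose q : ℝ)⁻¹) :=
    Finset.prod_nonneg fun T _ => by split_ifs <;> positivity
  have hterm : ∀ T : Finset (Fin (k + 1)), (0 : ℝ) ≤ if T.image x ∈ B then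
        (n : ℝ) ^ weightExponent k q (fun j => (α j).toReal) (T.card - 1) else 0 :=
    fun T => by split_ifs <;> positivity
  by_cases hbad : ∃ T : Finset (Fin (k + 1)), q + 2 ≤ T.card ∧ T.image x ∈ B
  -- Charge the embedding to a largest face in B: no face in the overlap has higher dimension, so
  -- the gain is at most that of all faces up to this dimension.
  · obtain ⟨T₀, hT₀, hmax⟩ := Finset.exists_max_image
      (Finset.univ.filter fun T : Finset (Fin (k + 1)) => q + 2 ≤ T.card ∧ T.image x ∈ B)
      Finset.card (by obtain ⟨T, hT⟩ := hbad; exact ⟨T, by simpa using hT⟩)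
    simp only [Finset.mem_filter, Finset.mem_univ, true_and] at hT₀ hmax
    refine le_trans ?_ (le_add_of_nonneg_left hprod)
    refine le_trans ?_ (Finset.single_le_sum (fun T _ => hterm T)
      (Finset.mem_filter.mpr ⟨Finset.mem_univ T₀, hT₀.1⟩))
    rw [if_pos hT₀.2]
    refine Real.rpow_le_rpow_of_exponent_le hn1 ?_
    rw [← sum_faceSet_card_le hq (fun j => h.toReal_eq_zero) (T₀.card - 1)]
    refine Finset.sum_le_sum_of_subset_of_nonneg ?_ fun T _ _ => ENNReal.toReal_nonneg
    intro T hT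
    rw [Finset.mem_filter] at hT ⊢
    refine ⟨hT.1, ?_⟩
    by_cases hTq : q + 2 ≤ T.card
    · have := hmax T ⟨hTq, hT.2⟩
      omega
    · omega
  · push Not at hbad
    refine le_trans ?_ (le_add_of_nonneg_right (Finset.sum_nonneg fun T _ => hterm T))
    have hpow : ∀ T : Finset (Fin (k + 1)),
        (if T.image x ∈ B then (n : ℝ) ^ ((k.choose q : ℝ) * (α q).toReal) else 1) ^
          ((k.choose q : ℝ)⁻¹) = (n : ℝ) ^ (if T.image x ∈ B then (α q).toReal else 0) := by
      intro T
      split_ifs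
      · rw [← Real.rpow_mul hn'.le]
        congr 1
        field_simp
      · simp
    simp only [hpow]
    rw [← Real.rpow_sum_of_pos hn', ← Finset.sum_filter]
    refine Real.rpow_le_rpow_of_exponent_le hn1 ?_
    rw [Finset.sum_filter, Finset.sum_filter, ← Finset.sum_subset
      (s₁ := Finset.powersetCard (q + 1) (Finset.univ : Finset (Fin (k + 1))))
      (s₂ := faceSet (Finset.univ : Finset (Fin (k + 1))))]
    · refine (Finset.sum_congr rfl fun T hT => ?_).le
      rw [(Finset.mem_powersetCard.mp hT).2]
      rfl
    · intro T hT
      rw [Finset.mem_powersetCard] at hT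
      rw [mem_faceSet]
      exact ⟨hT.1, by omega⟩
    · intro T hT hT'
      rw [mem_faceSet] at hT
      rw [Finset.mem_powersetCard] at hT'
      split_ifs with hB
      · have h1 : T.card < q + 2 := by
          by_contra hc
          exact hbad T (by omega) hB
        have h2 : T.card ≠ q + 1 := fun hc => hT' ⟨hT.1, hc⟩
        exact h.toReal_eq_zero (by omega) (by omega)
      · rfl

/-- Few sets of a given size contain few images. -/
theorem card_image_mem_le_real {ι : Type*} [Fintype ι] [DecidableEq ι] {k n : ℕ}
    (hι : Fintype.card ι ≤ k + 1) (T : Finset ι) (B : Finset (Finset (Fin n))) :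
    (n : ℝ) ^ T.card * ((Finset.univ.filter fun x : ι → Fin n => T.image x ∈ B).card : ℝ) ≤
      B.card * ((k + 1 : ℕ) ^ (k + 1) : ℝ) * (n : ℝ) ^ Fintype.card ι := by
  have hT : T.card ≤ Fintype.card ι := Finset.card_le_univ T
  have h1 := card_image_mem_le T B
  rw [Fintype.card_fin] at h1
  have h2 : T.card ^ T.card ≤ (k + 1) ^ (k + 1) :=
    (Nat.pow_le_pow_left (hT.trans hι) _).trans (Nat.pow_le_pow_right (by omega) (hT.trans hι))
  have h3 : n ^ T.card * (Finset.univ.filter fun x : ι → Fin n => T.image x ∈ B).card ≤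
      B.card * (k + 1) ^ (k + 1) * n ^ Fintype.card ι := by
    calc _ ≤ n ^ T.card * (B.card * ((k + 1) ^ (k + 1) * n ^ (Fintype.card ι - T.card))) := by
          refine Nat.mul_le_mul_left _ (h1.trans ?_)
          gcongr
      _ = B.card * (k + 1) ^ (k + 1) * (n ^ T.card * n ^ (Fintype.card ι - T.card)) := by ring
      _ = _ := by rw [← pow_add, Nat.add_sub_cancel' hT]
  exact_mod_cast h3

theorem growth_eq {k q n : ℕ} {α : ℕ → ℝ≥0∞} (hn : 0 < n) :
    growth k q α n * (n : ℝ) ^ ((k.choose q : ℝ) * (α q).toReal) = (n : ℝ) ^ (q + 1) := by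
  have hn' : (0 : ℝ) < n := by exact_mod_cast hn
  rw [growth, ← Real.rpow_add hn', sub_add_cancel, ← Real.rpow_natCast]
  push_cast
  rfl

/-- Finner's inequality with weight 1/C(k,q) on each (q+1)-set, admissible because C(k,q) of these
sets contain a given vertex. The gain of one face, raised to the power C(k,q), is n^{C(k,q)α_q};
this cancels the density |B|/n^{q+1} up to the factor c, so each factor has average at most 1 + cK.
-/
theorem Subcritical.sum_prod_le {k q : ℕ} {α : ℕ → ℝ≥0∞} (h : Subcritical k q α) {n : ℕ}
    (hn : 0 < n) {B : Finset (Finset (Fin n))} {c : ℝ} (hc : 0 ≤ c)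
    (hB : (B.card : ℝ) ≤ c * growth k q α n) :
    ∑ x : Fin (k + 1) → Fin n,
      ∏ T ∈ Finset.powersetCard (q + 1) (Finset.univ : Finset (Fin (k + 1))),
        (if T.image x ∈ B then (n : ℝ) ^ ((k.choose q : ℝ) * (α q).toReal) else 1) ^
          ((k.choose q : ℝ)⁻¹) ≤
      (n : ℝ) ^ (k + 1) * (1 + c * ((k + 1 : ℕ) ^ (k + 1) : ℝ)) ^ (2 ^ (k + 1)) := by
  have hn' : (0 : ℝ) < n := by exact_mod_cast hn
  have : NeZero n := ⟨hn.ne'⟩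
  have hdN : 0 < k.choose q := Nat.choose_pos h.2.2
  have hd : (0 : ℝ) < k.choose q := by exact_mod_cast hdN
  have hd1 : (1 : ℝ) ≤ k.choose q := by exact_mod_cast hdN
  set K : ℝ := ((k + 1 : ℕ) ^ (k + 1) : ℝ) with hK
  have hK0 : 0 ≤ K := by positivity
  have hF := sum_prod_rpow_le (V := Fin n)
    (Finset.powersetCard (q + 1) (Finset.univ : Finset (Fin (k + 1)))) id
    (w := fun _ => ((k.choose q : ℝ)⁻¹))
    (g := fun T x => if T.image x ∈ B then (n : ℝ) ^ ((k.choose q : ℝ) * (α q).toReal) else 1)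
    (b := fun _ => 1 + c * K) (fun _ _ => by positivity) ?_ ?_ ?_ ?_
  · refine hF.trans ?_
    simp only [Fintype.card_fin]
    refine mul_le_mul_of_nonneg_left ?_ (by positivity)
    have hbase : 1 ≤ 1 + c * K := by nlinarith [mul_nonneg hc hK0]
    calc _ ≤ ∏ T ∈ Finset.powersetCard (q + 1) (Finset.univ : Finset (Fin (k + 1))),
            (1 + c * K) := by
          refine Finset.prod_le_prod (fun _ _ => by positivity) fun _ _ => ?_
          calc _ ≤ (1 + c * K) ^ (1 : ℝ) :=
                Real.rpow_le_rpow_of_exponent_le hbase (inv_le_one_of_one_le₀ hd1)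
            _ = _ := Real.rpow_one _
      _ ≤ _ := by
          rw [Finset.prod_const]
          refine pow_le_pow_right₀ hbase ?_
          refine (Finset.card_le_univ _).trans ?_
          simp
  · intro v
    rw [Finset.sum_const, nsmul_eq_mul, ← div_eq_mul_inv, div_le_one hd]
    have := card_filter_mem_powersetCard_le v q
    rw [Fintype.card_fin] at this
    exact_mod_cast this
  · intro T x
    split_ifs <;> positivity
  · intro T x y hxy
    have : T.image x = T.image y := Finset.image_congr fun i hi => hxy i hi
    simp only [this]
  · intro T hT
    rw [Finset.mem_powersetCard] at hT
    simp only [Fintype.card_fin]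
    have h1 := card_image_mem_le_real (k := k) (by simp) T B
    rw [hT.2, Fintype.card_fin, ← growth_eq (k := k) (α := α) hn] at h1
    have hg := growth_pos (k := k) (q := q) (α := α) hn
    set G := growth k q α n
    set P := (n : ℝ) ^ ((k.choose q : ℝ) * (α q).toReal)
    have hP : 0 ≤ P := by positivity
    set N : ℝ := ((Finset.univ.filter fun x : Fin (k + 1) → Fin n => T.image x ∈ B).card : ℝ)
      with hN
    have h2 : P * N ≤ c * K * (n : ℝ) ^ (k + 1) := by
      refine le_of_mul_le_mul_left ?_ hg
      calc G * (P * N) = G * P * N := by ring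
        _ ≤ _ := h1
        _ ≤ c * G * K * (n : ℝ) ^ (k + 1) := by gcongr
        _ = _ := by ring
    calc _ ≤ ∑ x : Fin (k + 1) → Fin n, ((if T.image x ∈ B then P else 0) + 1) := by
          refine Finset.sum_le_sum fun x _ => ?_
          split_ifs <;> linarith
      _ = P * N + (n : ℝ) ^ (k + 1) := by
          rw [Finset.sum_add_distrib, ← Finset.sum_filter, Finset.sum_const]
          simp [hN, mul_comm]
      _ ≤ _ := by linarith

theorem sum_embedding_le {ι V : Type*} [Fintype ι] [DecidableEq ι] [Fintype V] [DecidableEq V]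
    {F : (ι → V) → ℝ} (hF : ∀ x, 0 ≤ F x) : ∑ f : ι ↪ V, F f ≤ ∑ x, F x := by
  have h := Finset.sum_map Finset.univ
    (⟨fun f : ι ↪ V => ⇑f, DFunLike.coe_injective⟩ : (ι ↪ V) ↪ (ι → V)) F
  exact h.symm.le.trans (Finset.sum_le_univ_sum_of_nonneg hF)

theorem exists_pos_one_add_mul_pow_le (K : ℝ) (N : ℕ) {δ : ℝ} (hδ : 0 < δ) :
    ∃ c : ℝ, 0 < c ∧ c ≤ 1 ∧ (1 + c * K) ^ N ≤ 1 + δ := by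
  have h1 : Tendsto (fun c : ℝ => (1 + c * K) ^ N) (nhds 0) (nhds 1) := by
    have : Continuous fun c : ℝ => (1 + c * K) ^ N := by fun_prop
    simpa using this.tendsto 0
  have h2 : ∀ᶠ c in nhdsWithin (0 : ℝ) (Set.Ioi 0), (1 + c * K) ^ N ≤ 1 + δ :=
    (h1.mono_left nhdsWithin_le_nhds).eventually_le_const (by linarith)
  obtain ⟨c, hc, hc'⟩ := (h2.and (Ioc_mem_nhdsGT (zero_lt_one' ℝ))).exists
  exact ⟨c, hc'.1, hc'.2, hc⟩

/-- The mean number of ordered simplices is hardly affected by conditioning on the presence of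
at most `c n^{q + 1 - (k choose q) α_q}` simplices. -/
theorem exists_sum_faceWeight_sdiff_le (k : ℕ) {δ : ℝ} (hδ : 0 < δ) :
    ∃ c : ℝ, 0 < c ∧ ∀ (α : ℕ → ℝ≥0∞) (q : ℕ), Subcritical k q α → ExtraCondition k q α →
      ∀ᶠ n : ℕ in atTop, ∀ B : Finset (Finset (Fin n)), (B.card : ℝ) ≤ c * growth k q α n →
        ∑ f : Fin (k + 1) ↪ Fin n,
          faceWeight (fun i => powProb n (α i)) (faceSet (Finset.univ.map f) \ B) ≤
        (1 + δ) * meanOrdered n (fun i => powProb n (α i)) (simplex k) := by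
  set K : ℝ := ((k + 1 : ℕ) ^ (k + 1) : ℝ) with hK
  have hK0 : 0 < K := by positivity
  obtain ⟨c, hc0, hc1, hc⟩ := exists_pos_one_add_mul_pow_le K (2 ^ (k + 1))
    (show 0 < δ / 4 by positivity)
  refine ⟨c, hc0, fun α q h hex => ?_⟩
  -- The sets T of size at least q+2 number at most 2^(k+1), so together they contribute at most
  -- δ/4. Finner's inequality costs another δ/4, and the remaining δ/2 pays for replacing n^{k+1} by
  -- the falling factorial.
  set η : ℝ := δ / 4 / (2 ^ (k + 1) * K) with hη
  have hη0 : 0 < η := by positivity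
  have hη1 : 0 < δ / (2 * (1 + δ)) := by positivity
  filter_upwards [eventually_growth_mul_le hex hη0, eventually_le_descFactorial (k + 1) hη1,
    eventually_gt_atTop 0] with n hsmall hdesc hn B hB
  have hn' : (0 : ℝ) < n := by exact_mod_cast hn
  rw [h.meanOrdered_eq hn]
  simp only [h.faceWeight_sdiff hn]
  rw [← Finset.mul_sum, mul_left_comm]
  refine mul_le_mul_of_nonneg_left ?_ (by positivity)
  have hmap : ∀ (f : Fin (k + 1) ↪ Fin n) (T : Finset (Fin (k + 1))), T.map f = T.image f :=
    fun f T => Finset.map_eq_image f T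
  simp only [hmap]
  have hbad : ∀ T : Finset (Fin (k + 1)), q + 2 ≤ T.card →
      ∑ x : Fin (k + 1) → Fin n, (if T.image x ∈ B then
        (n : ℝ) ^ weightExponent k q (fun j => (α j).toReal) (T.card - 1) else 0) ≤
      η * K * (n : ℝ) ^ (k + 1) := by
    intro T hT
    have hT2 : T.card ≤ k + 1 := by simpa using Finset.card_le_univ T
    have h1 := card_image_mem_le_real (k := k) (by simp) T B
    have h2 := hsmall (T.card - 1) (by omega) (by omega)
    rw [show T.card - 1 + 1 = T.card by omega] at h2
    rw [Fintype.card_fin] at h1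
    rw [← Finset.sum_filter, Finset.sum_const, nsmul_eq_mul]
    set E := (n : ℝ) ^ weightExponent k q (fun j => (α j).toReal) (T.card - 1)
    set N : ℝ := ((Finset.univ.filter fun x : Fin (k + 1) → Fin n => T.image x ∈ B).card : ℝ)
    have hE : 0 ≤ E := by positivity
    have hB' : (B.card : ℝ) ≤ growth k q α n := by
      nlinarith [growth_pos (k := k) (q := q) (α := α) hn]
    refine le_of_mul_le_mul_left ?_ (show (0 : ℝ) < (n : ℝ) ^ T.card by positivity)
    calc (n : ℝ) ^ T.card * (N * E) = ((n : ℝ) ^ T.card * N) * E := by ring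
      _ ≤ (growth k q α n * K * (n : ℝ) ^ (k + 1)) * E := by
          refine mul_le_mul_of_nonneg_right (h1.trans ?_) hE
          gcongr
      _ = (growth k q α n * E) * (K * (n : ℝ) ^ (k + 1)) := by ring
      _ ≤ (η * (n : ℝ) ^ T.card) * (K * (n : ℝ) ^ (k + 1)) := by gcongr
      _ = _ := by ring
  calc ∑ f : Fin (k + 1) ↪ Fin n,
        (n : ℝ) ^ (∑ T ∈ faceSet (Finset.univ : Finset (Fin (k + 1))) with T.image f ∈ B,
          (α (T.card - 1)).toReal)
      ≤ ∑ x : Fin (k + 1) → Fin n,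
        (n : ℝ) ^ (∑ T ∈ faceSet (Finset.univ : Finset (Fin (k + 1))) with T.image x ∈ B,
          (α (T.card - 1)).toReal) := by
        exact sum_embedding_le (F := fun x : Fin (k + 1) → Fin n =>
          (n : ℝ) ^ (∑ T ∈ faceSet (Finset.univ : Finset (Fin (k + 1))) with T.image x ∈ B,
            (α (T.card - 1)).toReal)) fun x => by positivity
    _ ≤ (n : ℝ) ^ (k + 1) * (1 + c * K) ^ (2 ^ (k + 1)) +
        ∑ T : Finset (Fin (k + 1)) with q + 2 ≤ T.card, η * K * (n : ℝ) ^ (k + 1) := by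
        refine (Finset.sum_le_sum fun x _ => h.rpow_overlap_le hn B x).trans ?_
        rw [Finset.sum_add_distrib]
        refine add_le_add (h.sum_prod_le hn hc0.le hB) ?_
        rw [Finset.sum_comm]
        exact Finset.sum_le_sum fun T hT => hbad T (Finset.mem_filter.mp hT).2
    _ ≤ (n : ℝ) ^ (k + 1) * (1 + δ / 4) + (n : ℝ) ^ (k + 1) * (δ / 4) := by
        refine add_le_add (by gcongr) ?_
        rw [Finset.sum_const, nsmul_eq_mul]
        have h3 : ((Finset.univ.filter fun T : Finset (Fin (k + 1)) => q + 2 ≤ T.card).card : ℝ) ≤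
            2 ^ (k + 1) := by
          have := Finset.card_le_univ
            (Finset.univ.filter fun T : Finset (Fin (k + 1)) => q + 2 ≤ T.card)
          rw [Fintype.card_finset, Fintype.card_fin] at this
          exact_mod_cast this
        calc _ ≤ (2 : ℝ) ^ (k + 1) * (η * K * (n : ℝ) ^ (k + 1)) := by gcongr
          _ = _ := by rw [hη]; field_simp
    _ = (1 + δ) * ((1 - δ / (2 * (1 + δ))) * (n : ℝ) ^ (k + 1)) := by
        field_simp
        ring
    _ ≤ _ := by gcongr

/-! ### The upper tail -/

theorem card_filter_mem_powersetCard {ι : Type*} [Fintype ι] [DecidableEq ι] (v : ι) (q : ℕ) :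
    ((Finset.powersetCard (q + 1) (Finset.univ : Finset ι)).filter fun T => v ∈ T).card =
      (Fintype.card ι - 1).choose q := by
  refine le_antisymm (card_filter_mem_powersetCard_le v q) ?_
  rw [← Finset.card_univ, ← Finset.card_erase_of_mem (Finset.mem_univ v),
    ← Finset.card_powersetCard]
  refine Finset.card_le_card_of_injOn (fun T => insert v T) ?_ ?_
  · intro T hT
    rw [Finset.mem_coe, Finset.mem_powersetCard] at hT
    have hv : v ∉ T := fun h => by simpa using hT.1 h
    rw [Finset.mem_coe, Finset.mem_filter, Finset.mem_powersetCard]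
    exact ⟨⟨Finset.subset_univ _, by rw [Finset.card_insert_of_notMem hv, hT.2]⟩,
      Finset.mem_insert_self _ _⟩
  · intro T hT T' hT' he
    rw [Finset.mem_coe, Finset.mem_powersetCard] at hT hT'
    have hv : v ∉ T := fun h => by simpa using hT.1 h
    have hv' : v ∉ T' := fun h => by simpa using hT'.1 h
    simp only at he
    rw [← Finset.erase_insert hv, ← Finset.erase_insert hv', he]

/-- The sets of size `q + 1` that meet `A`. -/
def meetingSets {V : Type*} [Fintype V] [DecidableEq V] (q : ℕ) (A : Finset V) :
    Finset (Finset V) :=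
  (Finset.powersetCard (q + 1) Finset.univ).filter fun T => ∃ v ∈ A, v ∈ T

theorem mem_meetingSets {V : Type*} [Fintype V] [DecidableEq V] {q : ℕ} {A T : Finset V} :
    T ∈ meetingSets q A ↔ T.card = q + 1 ∧ ∃ v ∈ A, v ∈ T := by
  simp [meetingSets, Finset.mem_powersetCard]

theorem card_meetingSets_le {V : Type*} [Fintype V] [DecidableEq V] (q : ℕ) (A : Finset V) :
    (meetingSets q A).card ≤ A.card * Fintype.card V ^ q := by
  have h : meetingSets q A ⊆ A.biUnion fun v =>
      (Finset.powersetCard (q + 1) (Finset.univ : Finset V)).filter fun T => v ∈ T := by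
    intro T hT
    rw [mem_meetingSets] at hT
    obtain ⟨hc, v, hv, hvT⟩ := hT
    simp only [Finset.mem_biUnion, Finset.mem_filter, Finset.mem_powersetCard, Finset.subset_univ,
      true_and]
    exact ⟨v, hv, hc, hvT⟩
  refine (Finset.card_le_card h).trans (Finset.card_biUnion_le_card_mul _ _ _ fun v _ => ?_)
  rw [card_filter_mem_powersetCard]
  exact (Nat.choose_le_pow _ _).trans (Nat.pow_le_pow_left (Nat.sub_le _ _) _)

/-- By symmetry: composing with a transposition shows that every value at i is taken by equally many
embeddings. -/
theorem card_mul_card_embedding_apply_mem {ι V : Type*} [Fintype ι] [DecidableEq ι] [Fintype V]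
    [DecidableEq V] (i : ι) (A : Finset V) :
    Fintype.card V * (Finset.univ.filter fun f : ι ↪ V => f i ∈ A).card =
      A.card * Fintype.card (ι ↪ V) := by
  have hswap : ∀ v w : V, (Finset.univ.filter fun f : ι ↪ V => f i = v).card ≤
      (Finset.univ.filter fun f : ι ↪ V => f i = w).card := by
    intro v w
    refine Finset.card_le_card_of_injOn (fun f => f.trans (Equiv.swap v w).toEmbedding) ?_ ?_
    · intro f hf
      simp only [Finset.coe_filter, Finset.mem_univ, true_and, Set.mem_ofPred_eq] at hf
      simp [hf]
    · intro f _ g _ hfg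
      ext x
      have := DFunLike.congr_fun hfg x
      simpa using this
  have hsum : ∀ A : Finset V, (Finset.univ.filter fun f : ι ↪ V => f i ∈ A).card =
      ∑ v ∈ A, (Finset.univ.filter fun f : ι ↪ V => f i = v).card := by
    intro A
    rw [Finset.card_eq_sum_card_fiberwise (f := fun f : ι ↪ V => f i) (t := A)
      (fun f hf => by simpa using hf)]
    refine Finset.sum_congr rfl fun v hv => ?_
    congr 1
    ext f
    simp only [Finset.mem_filter, Finset.mem_univ, true_and]
    exact ⟨fun h => h.2, fun h => ⟨h ▸ hv, h⟩⟩
  rcases isEmpty_or_nonempty V with hV | ⟨⟨w⟩⟩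
  · have : A = ∅ := Finset.eq_empty_of_isEmpty A
    simp [this]
  have hconst : ∀ v, (Finset.univ.filter fun f : ι ↪ V => f i = v).card =
      (Finset.univ.filter fun f : ι ↪ V => f i = w).card :=
    fun v => le_antisymm (hswap v w) (hswap w v)
  have h1 := hsum A
  have h2 := hsum Finset.univ
  simp only [hconst, Finset.sum_const, smul_eq_mul, Finset.mem_univ, Finset.filter_true,
    Finset.card_univ] at h1 h2
  rw [h1, h2]
  ring

/-- Keep only the embeddings sending 0 into A. They are a fraction |A|/n of all, and each gains
n^{α_q} from every one of its C(k,q) planted q-faces at 0. -/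
theorem Subcritical.le_sum_faceWeight_sdiff {k q : ℕ} {α : ℕ → ℝ≥0∞} (h : Subcritical k q α) {n : ℕ}
    (hn : 0 < n) (A : Finset (Fin n)) :
    (A.card : ℝ) * (n : ℝ) ^ ((k.choose q : ℝ) * (α q).toReal) *
        meanOrdered n (fun i => powProb n (α i)) (simplex k) ≤
      n * ∑ f : Fin (k + 1) ↪ Fin n,
        faceWeight (fun i => powProb n (α i)) (faceSet (Finset.univ.map f) \ meetingSets q A) := by
  have hn1 : (1 : ℝ) ≤ n := by exact_mod_cast hn
  have hcount := card_mul_card_embedding_apply_mem (0 : Fin (k + 1)) A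
  rw [Fintype.card_embedding_eq, Fintype.card_fin, Fintype.card_fin] at hcount
  have hcount' : (n : ℝ) * (Finset.univ.filter fun f : Fin (k + 1) ↪ Fin n => f 0 ∈ A).card =
      A.card * n.descFactorial (k + 1) := by exact_mod_cast hcount
  rw [h.meanOrdered_eq hn]
  simp only [h.faceWeight_sdiff hn]
  rw [← Finset.mul_sum]
  set Q := (n : ℝ) ^ (-weightExponent k q (fun j => (α j).toReal) k)
  set P := (n : ℝ) ^ ((k.choose q : ℝ) * (α q).toReal) with hP
  have hQ : 0 ≤ Q := by positivity
  have hle : ((Finset.univ.filter fun f : Fin (k + 1) ↪ Fin n => f 0 ∈ A).card : ℝ) * P ≤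
      ∑ f : Fin (k + 1) ↪ Fin n,
        (n : ℝ) ^ (∑ T ∈ faceSet (Finset.univ : Finset (Fin (k + 1))) with
          T.map f ∈ meetingSets q A, (α (T.card - 1)).toReal) := by
    rw [← nsmul_eq_mul, ← Finset.sum_const]
    refine le_trans (Finset.sum_le_sum fun f hf => ?_)
      (Finset.sum_le_sum_of_subset_of_nonneg (Finset.filter_subset _ _) fun f _ _ => by positivity)
    rw [Finset.mem_filter] at hf
    refine Real.rpow_le_rpow_of_exponent_le hn1 ?_
    have hcard := card_filter_mem_powersetCard (0 : Fin (k + 1)) q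
    rw [Fintype.card_fin, Nat.add_sub_cancel] at hcard
    rw [← hcard, ← nsmul_eq_mul, ← Finset.sum_const]
    calc _ = ∑ T ∈ (Finset.powersetCard (q + 1) (Finset.univ : Finset (Fin (k + 1)))).filter
            fun T => 0 ∈ T, (α (T.card - 1)).toReal := by
          refine Finset.sum_congr rfl fun T hT => ?_
          rw [Finset.mem_filter, Finset.mem_powersetCard] at hT
          rw [hT.1.2, Nat.add_sub_cancel]
      _ ≤ _ := by
          refine Finset.sum_le_sum_of_subset_of_nonneg ?_ fun T _ _ => ENNReal.toReal_nonneg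
          intro T hT
          rw [Finset.mem_filter, Finset.mem_powersetCard] at hT
          rw [Finset.mem_filter, mem_faceSet, mem_meetingSets, Finset.card_map]
          refine ⟨⟨hT.1.1, ?_⟩, hT.1.2, f 0, hf.2, Finset.mem_map_of_mem f hT.2⟩
          have := h.one_le
          omega
  calc _ = Q * (P * (A.card * n.descFactorial (k + 1))) := by ring
    _ = n * (Q * (((Finset.univ.filter fun f : Fin (k + 1) ↪ Fin n => f 0 ∈ A).card : ℝ) * P)) := by
        rw [← hcount']; ring
    _ ≤ _ := by gcongr

theorem Subcritical.exponent_pos {k q : ℕ} {α : ℕ → ℝ≥0∞} (h : Subcritical k q α) :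
    0 < (q : ℝ) + 1 - (k.choose q : ℝ) * (α q).toReal := by
  have := h.choose_mul_lt
  have : (0 : ℝ) ≤ q := Nat.cast_nonneg q
  linarith

theorem Subcritical.tendsto_growth {k q : ℕ} {α : ℕ → ℝ≥0∞} (h : Subcritical k q α) :
    Tendsto (growth k q α) atTop atTop :=
  tendsto_natCast_rpow_atTop h.exponent_pos

theorem Subcritical.meanOrdered_pos {k q : ℕ} {α : ℕ → ℝ≥0∞} (h : Subcritical k q α) {n : ℕ}
    (hn : k < n) : 0 < meanOrdered n (fun i => powProb n (α i)) (simplex k) := by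
  have hn0 : 0 < n := by omega
  have hn' : (0 : ℝ) < n := by exact_mod_cast hn0
  rw [h.meanOrdered_eq hn0]
  have : 0 < n.descFactorial (k + 1) := Nat.descFactorial_pos.mpr (by omega)
  positivity

theorem exists_upperTail_le_exp (k : ℕ) {ε : ℝ} (hε : 0 < ε) :
    ∃ c : ℝ, 0 < c ∧ ∀ (α : ℕ → ℝ≥0∞) (q : ℕ), Subcritical k q α → ExtraCondition k q α →
      ∀ᶠ n : ℕ in atTop, upperTail n (fun i => powProb n (α i)) (simplex k) ε ≤
        Real.exp (-(c * growth k q α n)) := by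
  obtain ⟨c, hc, hmain⟩ := exists_sum_faceWeight_sdiff_le k (show 0 < ε / 2 by positivity)
  set ρ := (1 + ε / 2) / (1 + ε) with hρ
  have hρ0 : 0 < ρ := by positivity
  have hρ1 : ρ < 1 := by rw [hρ, div_lt_one (by positivity)]; linarith
  have hlog : 0 < -Real.log ρ := neg_pos.mpr (Real.log_neg hρ0 hρ1)
  refine ⟨-Real.log ρ * (c / 2 ^ (k + 2)), by positivity, fun α q h hex => ?_⟩
  filter_upwards [hmain α q h hex, h.tendsto_growth.eventually_ge_atTop (2 ^ (k + 1) / c),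
    eventually_gt_atTop k] with n hB hg hn
  -- The moment of order ⌊y⌋ involves at most c·growth simplices. As y ≥ 1, rounding down loses at
  -- most a factor 2.
  set y := c * growth k q α n / 2 ^ (k + 1) with hy
  have hy1 : 1 ≤ y := by
    rw [hy, le_div_iff₀ (by positivity), one_mul]
    rw [div_le_iff₀ hc] at hg
    linarith
  have hfl : y / 2 ≤ (⌊y⌋₊ : ℝ) := by
    have h1 := Nat.lt_floor_add_one y
    have h2 : (1 : ℝ) ≤ ⌊y⌋₊ := by exact_mod_cast Nat.le_floor (by simpa using hy1)
    linarith
  refine (upperTail_le (M := ⌊y⌋₊) _ hε (by positivity) (h.meanOrdered_pos hn)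
    fun B hBM => hB B ?_).trans ?_
  · have h1 : (B.card : ℝ) ≤ (⌊y⌋₊ : ℝ) * 2 ^ (k + 1) := by exact_mod_cast hBM
    have h2 := Nat.floor_le (zero_le_one.trans hy1)
    calc (B.card : ℝ) ≤ _ := h1
      _ ≤ y * 2 ^ (k + 1) := by gcongr
      _ = _ := by rw [hy]; field_simp
  · rw [← hρ, ← Real.exp_log hρ0, ← Real.exp_nat_mul, Real.log_exp]
    refine Real.exp_le_exp.mpr ?_
    have h3 : c / 2 ^ (k + 2) * growth k q α n = y / 2 := by
      rw [hy, pow_succ 2 (k + 1)]; field_simp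
    rw [mul_assoc, h3]
    nlinarith

theorem exists_exp_le_upperTail (k : ℕ) {ε : ℝ} (hε : 0 < ε) :
    ∃ C : ℝ, 0 < C ∧ ∀ (α : ℕ → ℝ≥0∞) (q : ℕ), Subcritical k q α →
      ∀ᶠ n : ℕ in atTop, Real.exp (-(C * growth k q α n * Real.log n)) ≤
        upperTail n (fun i => powProb n (α i)) (simplex k) ε := by
  -- The first part bounds the planted simplices divided by growth, the 1 covering the ceiling. The
  -- term 2(k+1) pays for the lower bound n^{-(k+1)} on μ and the trivial bound n^{k+1} on the
  -- count, absorbed since growth ≥ 1.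
  refine ⟨2 * (1 + ε) + 1 + 2 * (k + 1), by positivity, fun α q h => ?_⟩
  set L : ℝ := 2 * (1 + ε) with hL
  have hpos : 0 < (k.choose q : ℝ) * (α q).toReal :=
    mul_pos (by exact_mod_cast Nat.choose_pos h.2.2) h.toReal_pos
  have hpos1 : 0 < 1 - (k.choose q : ℝ) * (α q).toReal := by linarith [h.choose_mul_lt]
  -- With P and R the two powers below, RP = n. So P ≥ L+1 leaves room for ⌈LR⌉ vertices among n,
  -- and R ≥ 1 gives ⌈LR⌉ ≤ (L+1)R.
  filter_upwards [(tendsto_natCast_rpow_atTop hpos).eventually_ge_atTop (L + 1),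
    (tendsto_natCast_rpow_atTop hpos1).eventually_ge_atTop 1,
    h.tendsto_growth.eventually_ge_atTop 1, eventually_gt_atTop k] with n hn1 hn2 hg hn
  have hn0 : 0 < n := by omega
  have hn' : (0 : ℝ) < n := by exact_mod_cast hn0
  have hn1' : (1 : ℝ) ≤ n := by exact_mod_cast hn0
  set P := (n : ℝ) ^ ((k.choose q : ℝ) * (α q).toReal) with hP
  set R := (n : ℝ) ^ (1 - (k.choose q : ℝ) * (α q).toReal) with hR
  have hRP : R * P = n := by
    rw [hR, hP, ← Real.rpow_add hn', sub_add_cancel, Real.rpow_one]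
  have hRg : R * (n : ℝ) ^ q = growth k q α n := by
    rw [hR, growth, ← Real.rpow_natCast, ← Real.rpow_add hn']
    congr 1
    ring
  have hP0 : 0 < P := by positivity
  have hR0 : 0 < R := by positivity
  have hceil : (⌈L * R⌉₊ : ℝ) ≤ (L + 1) * R := by
    have := Nat.ceil_lt_add_one (show 0 ≤ L * R by positivity)
    linarith
  have hle : ⌈L * R⌉₊ ≤ Fintype.card (Fin n) := by
    rw [Fintype.card_fin]
    have : (⌈L * R⌉₊ : ℝ) ≤ n := hceil.trans (by rw [← hRP, mul_comm]; gcongr)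
    exact_mod_cast this
  obtain ⟨A, -, hA⟩ := Finset.exists_subset_card_eq (s := (Finset.univ : Finset (Fin n))) hle
  set μ := meanOrdered n (fun i => powProb n (α i)) (simplex k) with hμ
  have hμ0 : 0 < μ := h.meanOrdered_pos hn
  have hkey := le_upperTail (fun i => powProb n (α i)) (ε := ε) (k := k) (meetingSets q A) ?_
  · have hBcard : ((meetingSets q A).card : ℝ) ≤ (L + 1) * growth k q α n := by
      have h1 := card_meetingSets_le q A
      rw [hA, Fintype.card_fin] at h1
      calc ((meetingSets q A).card : ℝ) ≤ (⌈L * R⌉₊ : ℝ) * (n : ℝ) ^ q := by exact_mod_cast h1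
        _ ≤ (L + 1) * R * (n : ℝ) ^ q := by gcongr
        _ = _ := by rw [← hRg]; ring
    have hw : (n : ℝ) ^ (-((L + 1) * growth k q α n)) ≤
        faceWeight (fun i => powProb n (α i)) (meetingSets q A) := by
      rw [h.faceWeight_eq hn0]
      · refine Real.rpow_le_rpow_of_exponent_le hn1' (neg_le_neg ?_)
        refine le_trans ?_ hBcard
        rw [← mul_one ((meetingSets q A).card : ℝ), ← nsmul_eq_mul]
        refine Finset.sum_le_card_nsmul _ _ _ fun T hT => ?_
        rw [(mem_meetingSets.mp hT).1, Nat.add_sub_cancel]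
        exact h.toReal_lt_one.le
      · intro T hT
        rw [(mem_meetingSets.mp hT).1]
        have := h.one_le
        have := h.2.2
        omega
    have hμlow : (n : ℝ) ^ (-((k : ℝ) + 1)) ≤ μ := by
      rw [hμ, h.meanOrdered_eq hn0]
      have h1 : (1 : ℝ) ≤ n.descFactorial (k + 1) := by
        exact_mod_cast Nat.descFactorial_pos.mpr (by omega)
      calc _ ≤ (n : ℝ) ^ (-weightExponent k q (fun j => (α j).toReal) k) * 1 := by
            rw [mul_one]
            exact Real.rpow_le_rpow_of_exponent_le hn1' (neg_le_neg h.weightExponent_le)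
        _ ≤ _ := by gcongr
    have hfin : (n : ℝ) ^ (-((L + 1) * growth k q α n)) * (n : ℝ) ^ (-((k : ℝ) + 1)) ≤
        (n : ℝ) ^ ((k : ℝ) + 1) * upperTail n (fun i => powProb n (α i)) (simplex k) ε := by
      have e : (n : ℝ) ^ ((k : ℝ) + 1) = (n : ℝ) ^ (k + 1) := by
        rw [← Real.rpow_natCast]; push_cast; rfl
      rw [e]
      refine le_trans (mul_le_mul hw (hμlow.trans ?_) (by positivity) (faceWeight_nonneg _ _)) hkey
      nlinarith
    rw [← Real.rpow_add hn'] at hfin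
    have hpow : (0 : ℝ) < (n : ℝ) ^ ((k : ℝ) + 1) := by positivity
    rw [← div_le_iff₀' hpow, ← Real.rpow_sub hn'] at hfin
    refine le_trans ?_ hfin
    rw [Real.rpow_def_of_pos hn']
    refine Real.exp_le_exp.mpr ?_
    have hlog : 0 ≤ Real.log n := Real.log_nonneg hn1'
    have hk : (0 : ℝ) ≤ k := Nat.cast_nonneg k
    have : 2 * ((k : ℝ) + 1) ≤ 2 * (k + 1) * growth k q α n := by nlinarith
    nlinarith
  · have h1 := h.le_sum_faceWeight_sdiff hn0 A
    rw [hA] at h1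
    refine le_of_mul_le_mul_left (le_trans ?_ h1) hn'
    rw [← hμ, ← hP]
    calc (n : ℝ) * (2 * ((1 + ε) * μ)) = L * R * P * μ := by rw [← hRP, hL]; ring
      _ ≤ _ := by
        gcongr
        exact Nat.le_ceil _

/-! ### The extremal parameter -/

instance {V : Type*} [Finite V] : Finite (PreAbstractSimplicialComplex V) :=
  Finite.of_injective (fun K => (K : Set (Finset V))) SetLike.coe_injective

theorem singleton_mem_of_mem {V : Type*} {K : PreAbstractSimplicialComplex V} {σ : Finset V}
    (hσ : σ ∈ K) {v : V} (hv : v ∈ σ) : v ∈ vertices K :=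
  (K.isRelLowerSet_faces hσ).2 (Finset.singleton_subset_iff.mpr hv) (Finset.singleton_nonempty v)

theorem exists_map_subtype {V : Type*} {K : PreAbstractSimplicialComplex V} {σ : Finset V}
    (hσ : σ ∈ K) : ∃ s : Finset (vertices K), s.map (Function.Embedding.subtype _) = σ := by
  classical
  refine ⟨σ.subtype (· ∈ vertices K), ?_⟩
  rw [Finset.subtype_map, Finset.filter_true_of_mem]
  exact fun v hv => singleton_mem_of_mem hσ hv

theorem mem_iff_of_iso {V W : Type*} [DecidableEq V] {F : PreAbstractSimplicialComplex W}
    {L : PreAbstractSimplicialComplex V} (e : vertices F ≃ vertices L)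
    (he : ∀ s : Finset (vertices F), s.map (Function.Embedding.subtype _) ∈ F ↔
      (s.map e.toEmbedding).map (Function.Embedding.subtype _) ∈ L) (σ : Finset V) :
    σ ∈ L ↔ ∃ s : Finset (vertices F), s.map (Function.Embedding.subtype _) ∈ F ∧
      s.image (fun w => (e w : V)) = σ := by
  have him : ∀ s : Finset (vertices F), s.image (fun w => (e w : V)) =
      (s.map e.toEmbedding).map (Function.Embedding.subtype _) := by
    intro s
    rw [Finset.map_map, Finset.map_eq_image]
    rfl
  constructor
  · intro hσ
    obtain ⟨t, rfl⟩ := exists_map_subtype hσ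
    have ht : (t.map e.symm.toEmbedding).map e.toEmbedding = t := by
      simp [Finset.map_map]
    refine ⟨t.map e.symm.toEmbedding, ?_, ?_⟩
    · rw [he, ht]; exact hσ
    · rw [him, ht]
  · rintro ⟨s, hs, rfl⟩
    rw [him, ← he]
    exact hs

/-- Choose one isomorphism for each copy. Its underlying map determines the copy, so distinct copies
give distinct maps in X. -/
theorem numUnordered_le_card {V W : Type*} [DecidableEq V]
    (F : PreAbstractSimplicialComplex V) (H : PreAbstractSimplicialComplex W)
    {X : Finset (vertices H → V)}
    (hX : ∀ x : vertices H → V, Function.Injective x →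
      (∀ s : Finset (vertices H), s.map (Function.Embedding.subtype _) ∈ H → s.image x ∈ F) →
      x ∈ X) :
    numUnordered F H ≤ X.card := by
  classical
  unfold numUnordered
  -- `Option` supplies a value for the L that are not copies, as there may be no map at all.
  have hex : ∀ L : PreAbstractSimplicialComplex V, ∃ x : Option (vertices H → V), IsIso H L →
      ∃ y, x = some y ∧ Function.Injective y ∧ ∀ σ, σ ∈ L ↔ ∃ s : Finset (vertices H),
        s.map (Function.Embedding.subtype _) ∈ H ∧ s.image y = σ := by
    intro L
    by_cases hL : IsIso H L
    · obtain ⟨e, he⟩ := hL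
      exact ⟨some fun w => (e w : V), fun _ => ⟨_, rfl,
        Subtype.val_injective.comp e.injective, mem_iff_of_iso e he⟩⟩
    · exact ⟨none, fun h => absurd h hL⟩
  choose g hg using hex
  rw [← Finset.card_map Function.Embedding.some, ← Set.ncard_coe_finset]
  refine Set.ncard_le_ncard_of_injOn g ?_ ?_ (Finset.finite_toSet _)
  · rintro L ⟨hLF, hL⟩
    obtain ⟨y, hy, hyinj, hyL⟩ := hg L hL
    rw [hy]
    simp only [Finset.coe_map, Function.Embedding.some_apply, Set.mem_image, Finset.mem_coe,
      Option.some.injEq, exists_eq_right]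
    exact hX y hyinj fun s hs => hLF ((hyL _).mpr ⟨s, hs, rfl⟩)
  · rintro L ⟨-, hL⟩ L' ⟨-, hL'⟩ heq
    obtain ⟨y, hy, -, hyL⟩ := hg L hL
    obtain ⟨y', hy', -, hyL'⟩ := hg L' hL'
    have : y = y' := by rw [hy, hy'] at heq; exact Option.some.inj heq
    subst this
    refine SetLike.ext fun σ => ?_
    rw [hyL, hyL']

theorem extremalNumber_le {W : Type*} {k n : ℕ} {m : ℕ → ℕ} (hm : m 0 = n)
    {H : PreAbstractSimplicialComplex W} {b : ℝ} (hb : 0 ≤ b)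
    (h : ∀ F : PreAbstractSimplicialComplex (Fin n), (∀ i ≤ k, numSimplices F i ≤ m i) →
      (numUnordered F H : ℝ) ≤ b) :
    (extremalNumber k m H : ℝ) ≤ b := by
  subst hm
  rw [← Nat.le_floor_iff hb]
  exact ciSup_le' fun F => Nat.le_floor (h F.1 F.2)

theorem le_extremalNumber {W : Type*} {k n : ℕ} {m : ℕ → ℕ} (hm : m 0 = n)
    {H : PreAbstractSimplicialComplex W} (F : PreAbstractSimplicialComplex (Fin n))
    (hF : ∀ i ≤ k, numSimplices F i ≤ m i) : numUnordered F H ≤ extremalNumber k m H := by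
  subst hm
  exact le_ciSup (f := fun F : {F : PreAbstractSimplicialComplex (Fin (m 0)) //
    ∀ i ≤ k, numSimplices F i ≤ m i} => numUnordered F.1 H) (Set.finite_range _).bddAbove ⟨F, hF⟩

theorem numSimplices_le_choose {V : Type*} [Fintype V] (K : PreAbstractSimplicialComplex V)
    (i : ℕ) : numSimplices K i ≤ (Fintype.card V).choose (i + 1) := by
  unfold numSimplices
  rw [← Finset.card_univ, ← Finset.card_powersetCard, ← Set.ncard_coe_finset]
  refine Set.ncard_le_ncard (fun σ hσ => ?_) (Finset.finite_toSet _)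
  rw [Finset.mem_coe, Finset.mem_powersetCard]
  exact ⟨Finset.subset_univ _, hσ.2⟩

theorem numSimplices_simplex (k i : ℕ) : numSimplices (simplex k) i = (k + 1).choose (i + 1) := by
  refine le_antisymm ((numSimplices_le_choose _ i).trans (by rw [Fintype.card_fin])) ?_
  unfold numSimplices
  conv_lhs => rw [← Fintype.card_fin (k + 1), ← Finset.card_univ, ← Finset.card_powersetCard,
    ← Set.ncard_coe_finset]
  refine Set.ncard_le_ncard (fun σ hσ => ?_) (Set.toFinite _)
  rw [Finset.mem_coe, Finset.mem_powersetCard] at hσ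
  exact ⟨mem_simplex_iff.mpr (Finset.card_pos.mp (by omega)), hσ.2⟩

theorem numSimplices_eq_card {W : Type*} (H : PreAbstractSimplicialComplex W)
    [Fintype (vertices H)]
    [DecidablePred fun T : Finset (vertices H) => T.map (Function.Embedding.subtype _) ∈ H]
    (i : ℕ) : numSimplices H i = ((Finset.powersetCard (i + 1) (Finset.univ : Finset (vertices H))
      ).filter fun T => T.map (Function.Embedding.subtype _) ∈ H).card := by
  classical
  unfold numSimplices
  rw [← Finset.card_map (Finset.mapEmbedding (Function.Embedding.subtype _)).toEmbedding,
    ← Set.ncard_coe_finset]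
  congr 1
  ext σ
  simp only [Set.mem_ofPred_eq, Finset.coe_map, Set.mem_image, Finset.mem_coe, Finset.mem_filter,
    Finset.mem_powersetCard, Finset.subset_univ, true_and, RelEmbedding.coe_toEmbedding,
    Finset.mapEmbedding_apply]
  constructor
  · rintro ⟨hσ, hc⟩
    obtain ⟨s, rfl⟩ := exists_map_subtype hσ
    exact ⟨s, ⟨by simpa using hc, hσ⟩, rfl⟩
  · rintro ⟨s, ⟨hc, hs⟩, rfl⟩
    exact ⟨hs, by simpa using hc⟩

theorem numSimplices_zero {W : Type*} (H : PreAbstractSimplicialComplex W)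
    [Fintype (vertices H)] : numSimplices H 0 = Fintype.card (vertices H) := by
  classical
  rw [numSimplices_eq_card, Finset.filter_true_of_mem]
  · simp
  · intro T hT
    rw [Finset.mem_powersetCard] at hT
    obtain ⟨v, rfl⟩ := Finset.card_eq_one.mp hT.2
    rw [Finset.map_singleton]
    exact v.2

theorem Subcritical.Psi_eq {W : Type*} {k q : ℕ} {α : ℕ → ℝ≥0∞} (h : Subcritical k q α) {n : ℕ}
    (hn : 0 < n) (H : PreAbstractSimplicialComplex W) :
    Psi k n (fun i => powProb n (α i)) H = (n : ℝ) ^ numSimplices H 0 *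
      (n : ℝ) ^ (-∑ i ∈ Finset.Icc 1 k, (numSimplices H i : ℝ) * (α i).toReal) := by
  have hn' : (0 : ℝ) < n := by exact_mod_cast hn
  rw [Psi, ← Finset.sum_neg_distrib, Real.rpow_sum_of_pos hn']
  congr 1
  refine Finset.prod_congr rfl fun i hi => ?_
  rw [Finset.mem_Icc] at hi
  rw [coe_powProb (h.ne_top hi.1 hi.2), ← Real.rpow_natCast, ← Real.rpow_mul hn'.le]
  congr 1
  ring

/-- A complex with `O(n^{q + 1 - (k choose q) α_q})` simplices in each dimension has few copies of
every subcomplex of the simplex. -/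
theorem Subcritical.numUnordered_le_Psi {k q : ℕ} {α : ℕ → ℝ≥0∞} (h : Subcritical k q α) {n : ℕ}
    (hn : 0 < n)
    (hsmall : ∀ k₀, q < k₀ → k₀ ≤ k →
      growth k q α n * (n : ℝ) ^ weightExponent k q (fun j => (α j).toReal) k₀ ≤
        1 * (n : ℝ) ^ (k₀ + 1))
    {F : PreAbstractSimplicialComplex (Fin n)}
    (hF : ∀ i, 1 ≤ i → i ≤ k →
      (numSimplices F i : ℝ) * ((k + 1 : ℕ) ^ (k + 1) : ℝ) ≤ growth k q α n)
    (H : PreAbstractSimplicialComplex (Fin (k + 1))) :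
    (numUnordered F H : ℝ) ≤ Psi k n (fun i => powProb n (α i)) H := by
  classical
  have hn' : (0 : ℝ) < n := by exact_mod_cast hn
  have hn1 : (1 : ℝ) ≤ n := by exact_mod_cast hn
  have : NeZero n := ⟨hn.ne'⟩
  have hq := h.one_le
  have hW : Fintype.card (vertices H) ≤ k + 1 := by
    simpa using Fintype.card_subtype_le (· ∈ vertices H)
  set K : ℝ := ((k + 1 : ℕ) ^ (k + 1) : ℝ) with hK
  have hK0 : 0 < K := by positivity
  rw [h.Psi_eq hn, numSimplices_zero]
  let B : ℕ → Finset (Finset (Fin n)) := fun t => Finset.univ.filter fun σ => σ ∈ F ∧ σ.card = t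
  have hBcard : ∀ i, (B (i + 1)).card = numSimplices F i := by
    intro i
    rw [numSimplices, ← Set.ncard_coe_finset]
    congr 1
    ext σ
    simp [B]
  have himg : ∀ (T : Finset (vertices H)) (x : vertices H → Fin n), Function.Injective x →
      T.image x ∈ F → T.image x ∈ B T.card := by
    intro T x hx hT
    simp [B, hT, Finset.card_image_of_injective _ hx]
  have hzero : ∀ i, (∀ T : Finset (vertices H), T.map (Function.Embedding.subtype _) ∈ H →
      T.card ≠ i + 1) → numSimplices H i = 0 := by
    intro i hi
    rw [numSimplices_eq_card, Finset.card_eq_zero, Finset.filter_eq_empty_iff]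
    intro T hT hTH
    exact hi T hTH (Finset.mem_powersetCard.mp hT).2
  by_cases hbad : ∃ T : Finset (vertices H), q + 2 ≤ T.card ∧
      T.map (Function.Embedding.subtype _) ∈ H
  -- If H has dimension t > q, it is enough to count placements of one simplex of top dimension. No
  -- larger simplex enters Ψ, so the extra condition closes the estimate.
  · obtain ⟨T, hT, hmax⟩ := Finset.exists_max_image
      (Finset.univ.filter fun T : Finset (vertices H) => q + 2 ≤ T.card ∧
        T.map (Function.Embedding.subtype _) ∈ H)
      Finset.card (by obtain ⟨T, hT⟩ := hbad; exact ⟨T, by simpa using hT⟩)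
    simp only [Finset.mem_filter, Finset.mem_univ, true_and] at hT hmax
    have hTk : T.card ≤ k + 1 := (Finset.card_le_univ T).trans hW
    obtain ⟨t, ht⟩ : ∃ t, T.card = t + 1 := ⟨T.card - 1, by omega⟩
    have hN := numUnordered_le_card F H
      (X := Finset.univ.filter fun x : vertices H → Fin n => T.image x ∈ B T.card)
      fun x hx hs => by simpa using himg T x hx (hs T hT.2)
    have h1 := card_image_mem_le_real hW T (B T.card)
    set N : ℝ := (numUnordered F H : ℝ)
    have hN' : N ≤ ((Finset.univ.filter fun x : vertices H → Fin n =>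
        T.image x ∈ B T.card).card : ℝ) := Nat.cast_le.mpr hN
    have h2 := hsmall t (by omega) (by omega)
    rw [ht, hBcard] at h1
    rw [ht] at hN'
    have h3 := hF t (by omega) (by omega)
    set E := weightExponent k q (fun j => (α j).toReal) t
    have hE : ∑ i ∈ Finset.Icc 1 k, (numSimplices H i : ℝ) * (α i).toReal ≤ E := by
      calc ∑ i ∈ Finset.Icc 1 k, (numSimplices H i : ℝ) * (α i).toReal
          = ∑ i ∈ Finset.Icc q t, (numSimplices H i : ℝ) * (α i).toReal := by
            symm
            refine Finset.sum_subset (Finset.Icc_subset_Icc hq (by omega)) fun i hi hi' => ?_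
            rw [Finset.mem_Icc] at hi hi'
            by_cases hiq : i < q
            · rw [h.toReal_eq_zero hi.1 hiq, mul_zero]
            · rw [hzero i, Nat.cast_zero, zero_mul]
              intro U hU hUc
              have := hmax U ⟨by omega, hU⟩
              omega
        _ ≤ _ := by
            refine Finset.sum_le_sum fun i _ => ?_
            refine mul_le_mul_of_nonneg_right ?_ ENNReal.toReal_nonneg
            have := numSimplices_le_choose H i
            rw [Fintype.card_fin] at this
            exact_mod_cast this
    refine le_trans ?_ (mul_le_mul_of_nonneg_left
      (Real.rpow_le_rpow_of_exponent_le hn1 (neg_le_neg hE)) (by positivity))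
    rw [Real.rpow_neg hn'.le, ← div_eq_mul_inv, le_div_iff₀ (by positivity)]
    refine le_of_mul_le_mul_left ?_ (show (0 : ℝ) < (n : ℝ) ^ (t + 1) by positivity)
    calc (n : ℝ) ^ (t + 1) * (N * (n : ℝ) ^ E)
        ≤ (n : ℝ) ^ (t + 1) * (((Finset.univ.filter fun x : vertices H → Fin n =>
            T.image x ∈ B (t + 1)).card : ℝ) * (n : ℝ) ^ E) := by gcongr
      _ ≤ (numSimplices F t * K * (n : ℝ) ^ Fintype.card (vertices H)) * (n : ℝ) ^ E := by
          rw [← mul_assoc]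
          gcongr
      _ ≤ (growth k q α n * (n : ℝ) ^ Fintype.card (vertices H)) * (n : ℝ) ^ E := by gcongr
      _ = (growth k q α n * (n : ℝ) ^ E) * (n : ℝ) ^ Fintype.card (vertices H) := by ring
      _ ≤ (1 * (n : ℝ) ^ (t + 1)) * (n : ℝ) ^ Fintype.card (vertices H) := by gcongr
      _ = _ := by ring
  · push Not at hbad
    have hdN : 0 < k.choose q := Nat.choose_pos h.2.2
    have hd : (0 : ℝ) < k.choose q := by exact_mod_cast hdN
    have hsum : ∑ i ∈ Finset.Icc 1 k, (numSimplices H i : ℝ) * (α i).toReal =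
        numSimplices H q * (α q).toReal := by
      refine Finset.sum_eq_single_of_mem q (Finset.mem_Icc.mpr ⟨hq, h.2.2⟩) fun i hi hiq => ?_
      rw [Finset.mem_Icc] at hi
      by_cases hlt : i < q
      · rw [h.toReal_eq_zero hi.1 hlt, mul_zero]
      · rw [hzero i, Nat.cast_zero, zero_mul]
        intro U hU hUc
        exact hbad U (by omega) hU
    rw [hsum]
    set J := (Finset.powersetCard (q + 1) (Finset.univ : Finset (vertices H))).filter
      fun T => T.map (Function.Embedding.subtype _) ∈ H with hJ
    have hJcard : numSimplices H q = J.card := numSimplices_eq_card H q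
    -- Indicators suffice here. As H has at most k+1 vertices, each lies in at most C(k,q) of its
    -- q-simplices, and the product of the bounds is exactly Ψ.
    have hFin := sum_prod_rpow_le (V := Fin n) J id (w := fun _ => ((k.choose q : ℝ)⁻¹))
      (g := fun T x => if T.image x ∈ B (q + 1) then 1 else 0)
      (b := fun _ => (n : ℝ) ^ (-((k.choose q : ℝ) * (α q).toReal)))
      (fun _ _ => by positivity) ?_ ?_ ?_ ?_
    · have hN := numUnordered_le_card F H
        (X := Finset.univ.filter fun x : vertices H → Fin n => ∀ T ∈ J, T.image x ∈ B (q + 1))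
        fun x hx hs => by
          rw [Finset.mem_filter]
          refine ⟨Finset.mem_univ _, fun T hT => ?_⟩
          rw [hJ, Finset.mem_filter, Finset.mem_powersetCard] at hT
          rw [← hT.1.2]
          exact himg T x hx (hs T hT.2)
      calc (numUnordered F H : ℝ) ≤ ((Finset.univ.filter fun x : vertices H → Fin n =>
            ∀ T ∈ J, T.image x ∈ B (q + 1)).card : ℝ) := by exact_mod_cast hN
        _ ≤ ∑ x : vertices H → Fin n, ∏ T ∈ J,
            (if T.image x ∈ B (q + 1) then (1 : ℝ) else 0) ^ ((k.choose q : ℝ)⁻¹) := by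
            rw [Finset.card_filter, Nat.cast_sum]
            refine Finset.sum_le_sum fun x _ => ?_
            split_ifs with hx
            · rw [Finset.prod_congr rfl fun T hT => by rw [if_pos (hx T hT), Real.one_rpow]]
              simp
            · rw [Nat.cast_zero]
              exact Finset.prod_nonneg fun T _ => by split_ifs <;> positivity
        _ ≤ _ := hFin
        _ = _ := by
            rw [Fintype.card_fin, Finset.prod_const, ← Real.rpow_mul hn'.le,
              ← Real.rpow_natCast _ J.card,
              ← Real.rpow_mul hn'.le, hJcard]
            congr 2
            field_simp
    · intro v
      rw [Finset.sum_const, nsmul_eq_mul, ← div_eq_mul_inv, div_le_one hd]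
      have h1 := card_filter_mem_powersetCard_le v q
      have h2 : (J.filter fun T => v ∈ T).card ≤ k.choose q :=
        (Finset.card_le_card (Finset.filter_subset_filter _ (Finset.filter_subset _ _))).trans
          (h1.trans (Nat.choose_le_choose _ (by omega)))
      exact_mod_cast h2
    · intro T x
      split_ifs <;> norm_num
    · intro T x y hxy
      have : T.image x = T.image y := Finset.image_congr fun i hi => hxy i hi
      simp only [this]
    · intro T hT
      rw [hJ, Finset.mem_filter, Finset.mem_powersetCard] at hT
      have h1 := card_image_mem_le_real hW T (B (q + 1))
      rw [hT.1.2, hBcard, ← growth_eq (k := k) (α := α) hn] at h1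
      have hg := growth_pos (k := k) (q := q) (α := α) hn
      have h3 := hF q hq h.2.2
      rw [Finset.sum_boole, Fintype.card_fin, Real.rpow_neg hn'.le, ← div_eq_mul_inv,
        le_div_iff₀ (by positivity)]
      refine le_of_mul_le_mul_left ?_ hg
      calc _ = growth k q α n * (n : ℝ) ^ ((k.choose q : ℝ) * (α q).toReal) *
            ((Finset.univ.filter fun x : vertices H → Fin n => T.image x ∈ B (q + 1)).card : ℝ) := by
            ring
        _ ≤ _ := h1
        _ ≤ _ := by gcongr

/-! ### The number `M^*` -/

theorem growth_le_pow {k q n : ℕ} {α : ℕ → ℝ≥0∞} (hn : 0 < n) (hqk : q ≤ k) :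
    growth k q α n ≤ (n : ℝ) ^ (k + 1) := by
  have hn1 : (1 : ℝ) ≤ n := by exact_mod_cast hn
  rw [growth, ← Real.rpow_natCast]
  refine Real.rpow_le_rpow_of_exponent_le hn1 ?_
  have h1 : (q : ℝ) ≤ k := by exact_mod_cast hqk
  have h2 : 0 ≤ (k.choose q : ℝ) * (α q).toReal := by positivity
  push_cast
  linarith

theorem exists_mul_growth_le_Mstar (k : ℕ) :
    ∃ c : ℝ, 0 < c ∧ ∀ (α : ℕ → ℝ≥0∞) (q : ℕ), Subcritical k q α → ExtraCondition k q α →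
      ∀ᶠ n : ℕ in atTop, c * growth k q α n ≤
        (Mstar k n (fun i => powProb n (α i)) (simplex k) : ℝ) := by
  set K : ℝ := ((k + 1 : ℕ) ^ (k + 1) : ℝ) with hK
  have hK0 : 0 < K := by positivity
  -- The power 2^(k+1) bounds every s_i(σ_k), K is the loss in counting maps with a given image, and
  -- the 2 is for rounding down to an integer.
  refine ⟨1 / (2 * (2 ^ (k + 1) * K)), by positivity, fun α q h hex => ?_⟩
  filter_upwards [eventually_growth_mul_le hex one_pos, eventually_le_descFactorial (k + 1)
    (η := 1 / 2) (by norm_num), h.tendsto_growth.eventually_ge_atTop (2 ^ (k + 1) * K),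
    eventually_gt_atTop 0] with n hsmall hdesc hg hn
  set y := growth k q α n / (2 ^ (k + 1) * K) with hy
  have hden : 0 < 2 ^ (k + 1) * K := by positivity
  have hy1 : 1 ≤ y := by rwa [hy, le_div_iff₀ hden, one_mul]
  have hfl : y / 2 ≤ (⌊y⌋₊ : ℝ) := by
    have h1 := Nat.lt_floor_add_one y
    have h2 : (1 : ℝ) ≤ ⌊y⌋₊ := by exact_mod_cast Nat.le_floor (by simpa using hy1)
    linarith
  have hfl' : (⌊y⌋₊ : ℝ) ≤ y := Nat.floor_le (by linarith)
  have hc : 1 / (2 * (2 ^ (k + 1) * K)) * growth k q α n = y / 2 := by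
    rw [hy]; field_simp
  rw [hc]
  refine hfl.trans (Nat.cast_le.mpr (le_csSup ⟨n.choose (k + 1), ?_⟩ ⟨?_, ?_, ?_⟩))
  · rintro m ⟨-, hm, -⟩
    rw [numSimplices_simplex, Nat.choose_self, Nat.cast_one, div_one] at hm
    exact_mod_cast hm
  · exact Nat.le_floor (by simpa using hy1)
  · rw [numSimplices_simplex, Nat.choose_self, Nat.cast_one, div_one]
    refine hfl'.trans ?_
    rw [Nat.choose_eq_descFactorial_div_factorial,
      Nat.cast_div (Nat.factorial_dvd_descFactorial _ _)
        (Nat.cast_ne_zero.mpr (Nat.factorial_ne_zero _)), hy,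
      div_le_div_iff₀ hden (Nat.cast_pos.mpr (Nat.factorial_pos _))]
    have h1 : ((k + 1).factorial : ℝ) ≤ K := by
      rw [hK]
      exact_mod_cast Nat.factorial_le_pow (k + 1)
    have h2 := growth_le_pow (α := α) hn h.2.2
    have h3 : (2 : ℝ) ≤ 2 ^ (k + 1) := by
      rw [pow_succ]; nlinarith [one_le_pow₀ (show (1 : ℝ) ≤ 2 by norm_num) (n := k)]
    calc growth k q α n * ((k + 1).factorial : ℝ) ≤ (n : ℝ) ^ (k + 1) * K := by gcongr
      _ = (1 - 1 / 2) * (n : ℝ) ^ (k + 1) * (2 * K) := by ring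
      _ ≤ _ := by gcongr
  · intro H _ _
    refine extremalNumber_le (n := n) (by simp) (mul_nonneg (by positivity)
      (Finset.prod_nonneg fun i _ => pow_nonneg (powProb n (α i)).2.1 _)) fun F hF => ?_
    refine h.numUnordered_le_Psi hn hsmall (fun i hi hik => ?_) H
    have h1 := hF i hik
    simp only [show i ≠ 0 by omega, if_false, numSimplices_simplex] at h1
    have h2 : (k + 1).choose (i + 1) ≤ 2 ^ (k + 1) := Nat.choose_le_two_pow _ _
    have h3 : (numSimplices F i : ℝ) ≤ (⌊y⌋₊ : ℝ) * 2 ^ (k + 1) := by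
      exact_mod_cast h1.trans (Nat.mul_le_mul_left _ h2)
    calc (numSimplices F i : ℝ) * K ≤ y * 2 ^ (k + 1) * K := by
          gcongr
          exact h3.trans (by gcongr)
      _ = _ := by rw [hy]; field_simp

/-! ### The star complex and the upper bound on M^* -/

/-- The complex of all simplices of dimension at most `q - 1`, or of dimension `q` and meeting `A`
(provided that `A` is nonempty). -/
def starComplex {V : Type*} [DecidableEq V] (q : ℕ) (A : Finset V) :
    PreAbstractSimplicialComplex V where
  faces := {T | T.Nonempty ∧ ∃ v ∈ A, (insert v T).card ≤ q + 1}
  isRelLowerSet_faces := fun {_} ⟨hne, v, hv, hT⟩ => ⟨hne, fun {_} hU hUne =>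
    ⟨hUne, v, hv, (Finset.card_le_card (Finset.insert_subset_insert _ hU)).trans hT⟩⟩

theorem mem_starComplex {V : Type*} [DecidableEq V] {q : ℕ} {A T : Finset V} :
    T ∈ starComplex q A ↔ T.Nonempty ∧ ∃ v ∈ A, (insert v T).card ≤ q + 1 :=
  Iff.rfl

theorem numSimplices_starComplex_self {V : Type*} [Fintype V] [DecidableEq V] (q : ℕ)
    (A : Finset V) : numSimplices (starComplex q A) q = (meetingSets q A).card := by
  rw [numSimplices, ← Set.ncard_coe_finset]
  congr 1
  ext T
  simp only [Set.mem_ofPred_eq, Finset.mem_coe, mem_meetingSets, mem_starComplex]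
  constructor
  · rintro ⟨⟨-, v, hv, hT⟩, hc⟩
    refine ⟨hc, v, hv, ?_⟩
    by_contra hvT
    rw [Finset.card_insert_of_notMem hvT] at hT
    omega
  · rintro ⟨hc, v, hv, hvT⟩
    refine ⟨⟨⟨v, hvT⟩, v, hv, ?_⟩, hc⟩
    rw [Finset.insert_eq_of_mem hvT, hc]

theorem numSimplices_starComplex_of_gt {V : Type*} [Fintype V] [DecidableEq V] {q i : ℕ}
    (A : Finset V) (hi : q < i) : numSimplices (starComplex q A) i = 0 := by
  rw [numSimplices, Set.ncard_eq_zero]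
  ext T
  simp only [Set.mem_ofPred_eq, mem_starComplex, Set.mem_empty_iff_false, iff_false, not_and]
  rintro ⟨-, v, -, hT⟩ hc
  have := Finset.card_le_card (Finset.subset_insert v T)
  omega

theorem isIso_map {V W : Type*} [DecidableEq V] (H : PreAbstractSimplicialComplex W) (f : W ↪ V) :
    IsIso H (H.map f) := by
  classical
  have hmem : ∀ s : Finset W, s.image f ∈ H.map f ↔ s ∈ H := by
    intro s
    constructor
    · rintro ⟨t, ht, hts⟩
      rwa [← Finset.image_injective f.injective hts]
    · intro hs
      exact ⟨s, hs, rfl⟩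
  have hv : ∀ w : vertices H, f w ∈ vertices (H.map f) := by
    intro w
    have := (hmem {(w : W)}).mpr w.2
    rwa [Finset.image_singleton] at this
  have hbij : Function.Bijective
      (fun w => ⟨f w, hv w⟩ : vertices H → vertices (H.map f)) := by
    refine ⟨fun w w' hww => Subtype.ext (f.injective (Subtype.mk.inj hww)), ?_⟩
    rintro ⟨v, t, ht, htv⟩
    replace htv : t.image f = {v} := htv
    have hcard : t.card = 1 := by
      rw [← Finset.card_image_of_injective t f.injective, htv, Finset.card_singleton]
    obtain ⟨w, rfl⟩ := Finset.card_eq_one.mp hcard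
    refine ⟨⟨w, ht⟩, Subtype.ext ?_⟩
    simpa using htv
  refine ⟨Equiv.ofBijective _ hbij, fun s => ?_⟩
  rw [← hmem]
  have : (s.map (Function.Embedding.subtype _)).image f = (s.map
        (Equiv.ofBijective _ hbij).toEmbedding).map
          (Function.Embedding.subtype _) := by
    rw [Finset.map_map, Finset.map_eq_image, Finset.map_eq_image, Finset.image_image]
    rfl
  rw [← this]

/-- Distinct copies arise from embeddings with multiplicity at most `v^v`. -/
theorem card_le_mul_numUnordered {V W : Type*} [Fintype V] [DecidableEq V] [Fintype W]
    [DecidableEq W] {F : PreAbstractSimplicialComplex V} {H : PreAbstractSimplicialComplex W}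
    (hH : ∀ w, w ∈ vertices H) (X : Finset (W ↪ V)) (hX : ∀ f ∈ X, H.map f ≤ F) :
    X.card ≤ Fintype.card W ^ Fintype.card W * numUnordered F H := by
  classical
  have h1 := Finset.card_le_mul_card_image (f := fun f : W ↪ V => H.map f) X
    (Fintype.card W ^ Fintype.card W) ?_
  · refine h1.trans (Nat.mul_le_mul_left _ ?_)
    rw [numUnordered, ← Set.ncard_coe_finset]
    refine Set.ncard_le_ncard (fun L hL => ?_) (Set.toFinite _)
    rw [Finset.mem_coe, Finset.mem_image] at hL
    obtain ⟨f, hf, rfl⟩ := hL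
    exact ⟨hX f hf, isIso_map H f⟩
  · intro L hL
    rw [Finset.mem_image] at hL
    obtain ⟨f, hf, rfl⟩ := hL
    -- Embeddings with the same image complex have the same vertex set, which leaves at most |W|
    -- values for each vertex.
    have hrange : ∀ g : W ↪ V, H.map g = H.map f → ∀ w, g w ∈ Finset.univ.image f := by
      intro g hg w
      have h2 : ({g w} : Finset V) ∈ H.map g := ⟨{w}, hH w, by simp⟩
      rw [hg] at h2
      obtain ⟨t, -, ht⟩ := h2
      have h3 : g w ∈ t.image f := by
        simp only at ht
        rw [ht]; exact Finset.mem_singleton_self _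
      exact Finset.image_subset_image (Finset.subset_univ t) h3
    calc (X.filter fun g : W ↪ V => H.map g = H.map f).card
        ≤ (Fintype.piFinset fun _ : W => Finset.univ.image f).card := by
          refine Finset.card_le_card_of_injOn (fun g : W ↪ V => (g : W → V)) ?_
            fun g _ g' _ hgg => DFunLike.coe_injective hgg
          intro g hg
          rw [Finset.mem_coe, Fintype.mem_piFinset]
          exact hrange g (Finset.mem_filter.mp hg).2
      _ = _ := by
          rw [Fintype.card_piFinset, Finset.prod_const, Finset.card_univ,
            Finset.card_image_of_injective _ f.injective, Finset.card_univ]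

theorem map_starComplex_le {V W : Type*} [DecidableEq V] [DecidableEq W] {q : ℕ} {w : W}
    {A : Finset V} (f : W ↪ V) (hf : f w ∈ A) :
    (starComplex q {w}).map f ≤ starComplex q A := by
  rintro _ ⟨T, ⟨hne, v, hv, hT⟩, rfl⟩
  rw [Finset.mem_singleton] at hv
  subst hv
  refine ⟨hne.image f, f v, hf, ?_⟩
  rw [← Finset.image_insert]
  exact Finset.card_image_le.trans hT

/-- Only the C(k,q) q-simplices at 0 are needed; all other factors in Ψ are at most 1 apart from
those of the vertices. -/
theorem Subcritical.Psi_starComplex_le {k q : ℕ} {α : ℕ → ℝ≥0∞} (h : Subcritical k q α) {n : ℕ}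
    (hn : 0 < n) :
    Psi k n (fun i => powProb n (α i)) (starComplex q {(0 : Fin (k + 1))}) ≤
      (n : ℝ) ^ (k + 1) * (n : ℝ) ^ (-((k.choose q : ℝ) * (α q).toReal)) := by
  have hn1 : (1 : ℝ) ≤ n := by exact_mod_cast hn
  rw [h.Psi_eq hn]
  refine mul_le_mul (pow_le_pow_right₀ hn1 ?_) (Real.rpow_le_rpow_of_exponent_le hn1
    (neg_le_neg ?_)) (by positivity) (by positivity)
  · simpa using numSimplices_le_choose (starComplex q {(0 : Fin (k + 1))}) 0
  · have hq : numSimplices (starComplex q {(0 : Fin (k + 1))}) q = k.choose q := by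
      rw [numSimplices_starComplex_self, meetingSets]
      have := card_filter_mem_powersetCard (0 : Fin (k + 1)) q
      rw [Fintype.card_fin, Nat.add_sub_cancel] at this
      simpa using this
    rw [← hq]
    exact Finset.single_le_sum
      (f := fun i => (numSimplices (starComplex q {(0 : Fin (k + 1))}) i : ℝ) * (α i).toReal)
      (fun i _ => by positivity) (Finset.mem_Icc.mpr ⟨h.one_le, h.2.2⟩)

/-- In dimensions strictly between 0 and q even the complete skeleton is affordable, because n^{i+1}
≤ n^q ≤ m; above q there is nothing. -/
theorem numSimplices_starComplex_le {n k q a m : ℕ} (hn : 0 < n) (ha : 0 < a) {A : Finset (Fin n)}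
    (hA : A.card = a) (hm : a * n ^ q ≤ m) {i : ℕ} (hi : i ≤ k) :
    numSimplices (starComplex q A) i ≤ if i = 0 then n else m * numSimplices (simplex k) i := by
  split_ifs with h0
  · subst h0
    simpa using numSimplices_le_choose (starComplex q A) 0
  · rw [numSimplices_simplex]
    refine le_trans ?_ (Nat.le_mul_of_pos_right m (Nat.choose_pos (by omega)))
    rcases lt_trichotomy i q with hlt | rfl | hgt
    · have h1 := numSimplices_le_choose (starComplex q A) i
      rw [Fintype.card_fin] at h1
      calc _ ≤ n ^ (i + 1) := h1.trans (Nat.choose_le_pow _ _)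
        _ ≤ n ^ q := Nat.pow_le_pow_right hn hlt
        _ ≤ a * n ^ q := Nat.le_mul_of_pos_left _ ha
        _ ≤ m := hm
    · rw [numSimplices_starComplex_self]
      have h1 := card_meetingSets_le i A
      rw [hA, Fintype.card_fin] at h1
      exact h1.trans hm
    · rw [numSimplices_starComplex_of_gt A hgt]
      exact Nat.zero_le _

/-- If m exceeds |A|n^q, the star complex of A is admissible. It contains at least a constant times
|A|n^k copies of the star of a vertex of σ_k, more than Ψ allows. -/
theorem exists_Mstar_le_mul_growth (k : ℕ) :
    ∃ C : ℝ, 0 < C ∧ ∀ (α : ℕ → ℝ≥0∞) (q : ℕ), Subcritical k q α →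
      ∀ᶠ n : ℕ in atTop,
        (Mstar k n (fun i => powProb n (α i)) (simplex k) : ℝ) ≤ C * growth k q α n := by
  set K : ℝ := ((k + 1 : ℕ) ^ (k + 1) : ℝ) with hK
  have hK0 : 0 < K := by positivity
  -- Admissibility of m would force |A|P ≤ 2Kn, where K bounds the multiplicity of a copy and 2
  -- comes from the falling factorial. Any L > 2K contradicts this.
  set L : ℝ := 2 * K + 1 with hL
  refine ⟨L + 1, by positivity, fun α q h => ?_⟩
  have hpos : 0 < (k.choose q : ℝ) * (α q).toReal :=
    mul_pos (by exact_mod_cast Nat.choose_pos h.2.2) h.toReal_pos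
  have hpos1 : 0 < 1 - (k.choose q : ℝ) * (α q).toReal := by linarith [h.choose_mul_lt]
  filter_upwards [(tendsto_natCast_rpow_atTop hpos).eventually_ge_atTop (L + 1),
    (tendsto_natCast_rpow_atTop hpos1).eventually_ge_atTop 1,
    eventually_le_descFactorial (k + 1) (η := 1 / 2) (by norm_num),
    eventually_gt_atTop 0] with n hn1 hn2 hdesc hn
  have hn' : (0 : ℝ) < n := by exact_mod_cast hn
  set P := (n : ℝ) ^ ((k.choose q : ℝ) * (α q).toReal) with hP
  set R := (n : ℝ) ^ (1 - (k.choose q : ℝ) * (α q).toReal) with hR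
  have hRP : R * P = n := by
    rw [hR, hP, ← Real.rpow_add hn', sub_add_cancel, Real.rpow_one]
  have hRg : R * (n : ℝ) ^ q = growth k q α n := by
    rw [hR, growth, ← Real.rpow_natCast, ← Real.rpow_add hn']
    congr 1
    ring
  have hP0 : 0 < P := by positivity
  have hR0 : 0 < R := by positivity
  set a := ⌈L * R⌉₊ with ha
  have hceil : (a : ℝ) ≤ (L + 1) * R := by
    have := Nat.ceil_lt_add_one (show 0 ≤ L * R by positivity)
    linarith
  have ha0 : 0 < a := Nat.ceil_pos.mpr (by positivity)
  have hle : a ≤ Fintype.card (Fin n) := by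
    rw [Fintype.card_fin]
    have : (a : ℝ) ≤ n := hceil.trans (by rw [← hRP, mul_comm]; gcongr)
    exact_mod_cast this
  obtain ⟨A, -, hA⟩ := Finset.exists_subset_card_eq (s := (Finset.univ : Finset (Fin n))) hle
  have hbound : Mstar k n (fun i => powProb n (α i)) (simplex k) ≤ a * n ^ q := by
    refine csSup_le' ?_
    rintro m ⟨-, -, hm⟩
    by_contra hlt
    rw [not_le] at hlt
    set H := starComplex q {(0 : Fin (k + 1))} with hH
    have hvert : ∀ w, w ∈ vertices H := by
      intro w
      refine mem_starComplex.mpr ⟨Finset.singleton_nonempty w, 0, Finset.mem_singleton_self _, ?_⟩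
      have := Finset.card_insert_le (0 : Fin (k + 1)) {w}
      rw [Finset.card_singleton] at this
      have := h.one_le
      omega
    have hne : H ≠ ⊥ := by
      intro hbot
      have h0 : ({0} : Finset (Fin (k + 1))) ∈ H := hvert 0
      rw [hbot] at h0
      exact h0
    have h1 := hm H le_top hne
    have h2 := le_extremalNumber (k := k) (n := n)
      (m := fun i => if i = 0 then n else m * numSimplices (simplex k) i) (by simp) (H := H)
      (starComplex q A) fun i hi => numSimplices_starComplex_le hn ha0 hA hlt.le hi
    have h3 := card_le_mul_numUnordered (F := starComplex q A) hvert
      (Finset.univ.filter fun f : Fin (k + 1) ↪ Fin n => f 0 ∈ A)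
      fun f hf => map_starComplex_le f (Finset.mem_filter.mp hf).2
    have h4 := card_mul_card_embedding_apply_mem (0 : Fin (k + 1)) A
    rw [Fintype.card_embedding_eq, Fintype.card_fin, Fintype.card_fin, hA] at h4
    rw [Fintype.card_fin] at h3
    have h5 : (numUnordered (starComplex q A) H : ℝ) ≤
        (n : ℝ) ^ (k + 1) * (n : ℝ) ^ (-((k.choose q : ℝ) * (α q).toReal)) :=
      (Nat.cast_le.mpr h2).trans (h1.trans (h.Psi_starComplex_le hn))
    rw [Real.rpow_neg hn'.le, ← div_eq_mul_inv, ← hP, le_div_iff₀ hP0] at h5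
    have h6 : (a : ℝ) * n.descFactorial (k + 1) ≤
        n * (K * numUnordered (starComplex q A) H) := by
      have : a * n.descFactorial (k + 1) ≤
          n * ((k + 1) ^ (k + 1) * numUnordered (starComplex q A) H) := by
        rw [← h4]
        exact Nat.mul_le_mul_left _ h3
      rw [hK]
      exact_mod_cast this
    set N : ℝ := (numUnordered (starComplex q A) H : ℝ)
    have hNpow : (0 : ℝ) < (n : ℝ) ^ (k + 1) := by positivity
    have h7 : (a : ℝ) * ((1 - 1 / 2) * (n : ℝ) ^ (k + 1)) * P ≤ n * K * (n : ℝ) ^ (k + 1) := by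
      calc _ ≤ (a : ℝ) * n.descFactorial (k + 1) * P := by gcongr
        _ ≤ n * (K * N) * P := by gcongr
        _ = n * K * (N * P) := by ring
        _ ≤ _ := by gcongr
    have h8 : (a : ℝ) * P ≤ 2 * K * n := by
      refine le_of_mul_le_mul_right ?_ hNpow
      linarith
    have h9 : L * R * P ≤ a * P := mul_le_mul_of_nonneg_right (Nat.le_ceil _) hP0.le
    rw [mul_assoc, hRP] at h9
    rw [hL] at h9
    nlinarith
  calc (Mstar k n (fun i => powProb n (α i)) (simplex k) : ℝ) ≤ (a : ℝ) * (n : ℝ) ^ q := by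
        exact_mod_cast hbound
    _ ≤ (L + 1) * R * (n : ℝ) ^ q := by gcongr
    _ = _ := by rw [← hRg]; ring

end SimplexTail

end

theorem proposition4p1 (k : ℕ) (hk : 1 ≤ k) :
    (∃ C : ℝ, 1 ≤ C ∧ ∀ (α : ℕ → ℝ≥0∞) (q : ℕ),
      SimplexTail.Subcritical k q α → SimplexTail.ExtraCondition k q α →
      ∀ᶠ n : ℕ in atTop,
        C⁻¹ * SimplexTail.growth k q α n ≤
          (SimplexTail.Mstar k n (fun i => SimplexTail.powProb n (α i))
            (SimplexTail.simplex k) : ℝ) ∧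
        (SimplexTail.Mstar k n (fun i => SimplexTail.powProb n (α i))
            (SimplexTail.simplex k) : ℝ) ≤ C * SimplexTail.growth k q α n) ∧
    (∀ ε : ℝ, 0 < ε → ∃ C' C'' : ℝ, 0 < C' ∧ 0 < C'' ∧ ∀ (α : ℕ → ℝ≥0∞) (q : ℕ),
      SimplexTail.Subcritical k q α → SimplexTail.ExtraCondition k q α →
      ∀ᶠ n : ℕ in atTop,
        Real.exp (-(C' * SimplexTail.growth k q α n * Real.log n)) ≤
          SimplexTail.upperTail n (fun i => SimplexTail.powProb n (α i))
            (SimplexTail.simplex k) ε ∧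
        SimplexTail.upperTail n (fun i => SimplexTail.powProb n (α i))
            (SimplexTail.simplex k) ε ≤
          Real.exp (-(C'' * SimplexTail.growth k q α n))) := by
  refine ⟨?_, fun ε hε => ?_⟩
  · obtain ⟨c, hc, h1⟩ := SimplexTail.exists_mul_growth_le_Mstar k
    obtain ⟨C, hC, h2⟩ := SimplexTail.exists_Mstar_le_mul_growth k
    refine ⟨max 1 (max c⁻¹ C), le_max_left _ _, fun α q h hex => ?_⟩
    filter_upwards [h1 α q h hex, h2 α q h, eventually_gt_atTop 0] with n hn1 hn2 hn
    have hg := SimplexTail.growth_pos (k := k) (q := q) (α := α) hn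
    refine ⟨le_trans (mul_le_mul_of_nonneg_right ?_ hg.le) hn1,
      hn2.trans (mul_le_mul_of_nonneg_right ?_ hg.le)⟩
    · exact inv_le_of_inv_le₀ hc ((le_max_left _ _).trans (le_max_right _ _))
    · exact (le_max_right _ _).trans (le_max_right _ _)
  · obtain ⟨C, hC, h1⟩ := SimplexTail.exists_exp_le_upperTail k hε
    obtain ⟨c, hc, h2⟩ := SimplexTail.exists_upperTail_le_exp k hε
    exact ⟨C, c, hC, hc, fun α q h hex => (h1 α q h).and (h2 α q h hex)⟩
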